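/- Let $f:[0,\infty)\to\mathbb R$ be not almost everywhere zero, and suppose that $W(x,y)=f(x)f(y)\mathbf 1[x\neq y]$ is a graphex, that is, $W:[0,\infty)^2\to[0,1]$ is measurable and symmetric and, with $\mu_W(x)=\int_0^\infty W(x,y)\,dy$ and $|\cdot|$ Lebesgue measure: $|\{\mu_W=\infty\}|=0$, $|\{\mu_W>1\}|<\infty$, $\iint W(x,y)\mathbf 1[\mu_W(x)\le 1]\mathbf 1[\mu_W(y)\le 1]\,dx\,dy<\infty$ and $\int W(x,x)\,dx<\infty$. Let $\{(\theta_i,\vartheta_i)\}_{i\in\mathbb N}$ be (a measurable enumeration of) a unit rate Poisson process on $[0,\infty)^2$ and let $(\zeta_{\{i,j\}})$, indexed by the unordered pairs $\{i,j\}$ (with $i=j$ allowed), be independent random variables that are uniform on $[0,1]$ and independent of $(\theta_i,\vartheta_i)_{i}$. For $\nu\ge 0$ let $G_\nu$ be the $\nu$-truncation of the Kallenberg exchangeable graph associated with $W$: its edges are the pairs $\{\theta_i,\theta_j\}$ with $\theta_i,\theta_j\le\nu$ and $W(\vartheta_i,\vartheta_j)>\zeta_{\{i,j\}}$, and its vertex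 set $v(G_\nu)$ consists of the labels $\theta_i$ that take part in at least one of these edges. Let $C_1(G_\nu)$ be the largest connected component of $G_\nu$. Then for every $\epsilon>0$, $$\lim_{\nu\to\infty}P\bigl(|v(G_\nu)|<\infty\ \text{ and }\ |C_1(G_\nu)|>(1-\epsilon)\,|v(G_\nu)|\bigr)=1 .$$ -/

import Mathlib

open MeasureTheory ProbabilityTheory Filter Topology
open scoped NNReal ENNReal

namespace KEG

/-- Lebesgue measure on the half-line `[0, ∞)`. -/
noncomputable def leb : Measure ℝ≥0 := (volume : Measure ℝ).comap ((↑) : ℝ≥0 → ℝ)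

instance : SigmaFinite leb := by
  have he : MeasurableEmbedding ((↑) : ℝ≥0 → ℝ) :=
    MeasurableEmbedding.subtype_coe measurableSet_Ici
  refine SigmaFinite.of_map leb he.measurable.aemeasurable ?_
  rw [leb, he.map_comap]
  infer_instance

/-- Lebesgue measure on the quadrant `[0, ∞)²`. -/
noncomputable def leb2 : Measure (ℝ≥0 × ℝ≥0) := leb.prod leb

/-- The graphex marginal `μ_W(x) = ∫ W(x, y) dy`, with values in `[0, ∞]`. -/
noncomputable def marginal (W : ℝ≥0 → ℝ≥0 → ℝ) (x : ℝ≥0) : ℝ≥0∞ :=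
  ∫⁻ y, ENNReal.ofReal (W x y) ∂leb

/-- `W : [0, ∞)² → [0, 1]` is (the third component of) a graphex `(0, 0, W)`: it is measurable and
symmetric, and satisfies the local finiteness conditions. -/
structure IsGraphex (W : ℝ≥0 → ℝ≥0 → ℝ) : Prop where
  measurable : Measurable (fun p : ℝ≥0 × ℝ≥0 => W p.1 p.2)
  mem_Icc : ∀ x y, W x y ∈ Set.Icc (0 : ℝ) 1
  symm : ∀ x y, W x y = W y x
  marginal_top : leb {x | marginal W x = ⊤} = 0
  marginal_gt_one : leb {x | 1 < marginal W x} < ⊤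
  integral_small :
    ∫⁻ x in {x | marginal W x ≤ 1}, ∫⁻ y in {y | marginal W y ≤ 1},
      ENNReal.ofReal (W x y) ∂leb ∂leb < ⊤
  integral_diag : ∫⁻ x, ENNReal.ofReal (W x x) ∂leb < ⊤

open Classical in
/-- The separable kernel `W(x, y) = f(x) f(y) 1[x ≠ y]`. -/
noncomputable def separable (f : ℝ≥0 → ℝ) (x y : ℝ≥0) : ℝ :=
  if x = y then 0 else f x * f y

/-- The number of points in `A` of a sequence of points, counted with multiplicity. -/
noncomputable def count {E : Type*} (p : ℕ → E) (A : Set E) : ℕ∞ :=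
  {i | p i ∈ A}.encard

/-- The random points `X 0, X 1, …` enumerate a Poisson process with intensity measure `m`:
the number of points in a measurable set `A` of finite measure has the Poisson law of mean `m A`,
and the numbers of points in finitely many disjoint such sets are independent. -/
structure IsPoissonProcess {Ω E : Type*} [MeasurableSpace Ω] [MeasurableSpace E]
    (X : ℕ → Ω → E) (m : Measure E) (P : Measure Ω) : Prop where
  measurable : ∀ i, Measurable (X i)
  hasLaw : ∀ A : Set E, MeasurableSet A → m A < ⊤ →
    HasLaw (fun ω => count (fun i => X i ω) A)
      ((poissonMeasure (m A).toNNReal).map ((↑) : ℕ → ℕ∞)) P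
  indep : ∀ (n : ℕ) (A : Fin n → Set E), (∀ k, MeasurableSet (A k)) → (∀ k, m (A k) < ⊤) →
    (∀ k l, k ≠ l → Disjoint (A k) (A l)) →
    iIndepFun (fun k ω => count (fun i => X i ω) (A k)) P

/-- The randomness of a Kallenberg exchangeable graph: a unit rate Poisson process
`(θ_i, ϑ_i)` on the quadrant, and an independent family, indexed by the unordered pairs `{i, j}`
(`i = j` allowed), of i.i.d. variables that are uniform on `[0, 1]`. -/
structure IsLatent {Ω : Type*} [MeasurableSpace Ω] (X : ℕ → Ω → ℝ≥0 × ℝ≥0)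
    (ζ : Sym2 ℕ → Ω → ℝ) (P : Measure Ω) : Prop where
  poisson : IsPoissonProcess X leb2 P
  measurable : ∀ e, Measurable (ζ e)
  uniform : ∀ e, HasLaw (ζ e) (volume.restrict (Set.Icc (0 : ℝ) 1)) P
  iIndep : iIndepFun ζ P
  indep : IndepFun (fun ω i => X i ω) (fun ω e => ζ e ω) P

/-- The pair of labels `(a, b)` is an edge of the truncation `G_ν` of the graph with
latent points `x i = (θ_i, ϑ_i)` and edge variables `z`: both labels are at most `ν`, and
they are the labels of points `i`, `j` with `W(ϑ_i, ϑ_j) > z_{i, j}`. -/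
def IsEdge (W : ℝ≥0 → ℝ≥0 → ℝ) (x : ℕ → ℝ≥0 × ℝ≥0) (z : Sym2 ℕ → ℝ) (ν a b : ℝ≥0) : Prop :=
  a ≤ ν ∧ b ≤ ν ∧ ∃ i j, (x i).1 = a ∧ (x j).1 = b ∧ z s(i, j) < W (x i).2 (x j).2

/-- The vertices of `G_ν`: the labels that take part in at least one edge of `G_ν`. -/
def vertexSet (W : ℝ≥0 → ℝ≥0 → ℝ) (x : ℕ → ℝ≥0 × ℝ≥0) (z : Sym2 ℕ → ℝ) (ν : ℝ≥0) : Set ℝ≥0 :=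
  {a | ∃ b, IsEdge W x z ν a b}

/-- The truncation `G_ν` as a graph on its vertex set. Self edges, which do not affect
connectivity, are dropped. -/
def graph (W : ℝ≥0 → ℝ≥0 → ℝ) (x : ℕ → ℝ≥0 × ℝ≥0) (z : Sym2 ℕ → ℝ) (ν : ℝ≥0) :
    SimpleGraph (vertexSet W x z ν) :=
  SimpleGraph.fromRel (fun a b => IsEdge W x z ν a b)

/-- The number of vertices of the largest connected component of a graph. -/
noncomputable def largestComponentSize {V : Type*} (G : SimpleGraph V) : ℕ∞ :=
  ⨆ C : G.ConnectedComponent, C.supp.encard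

end KEG

/-!
Off the diagonal `f x * f y ∈ [0, 1]`, so the kernel is `|f x| * |f y|` there, and the local
finiteness conditions force `∫ |f| < ∞`. Hence each latent point with label at most `ν` gets a
weight `|f ϑ|`, these weights have almost surely a finite sum, and given the latent points two of
them are joined with probability the product of their weights, independently.

Let the core consist of the points of weight at least `δ`. Two core points have a given third one as
a common neighbour with probability at least `δ ^ 4`, so a core of `k` points is linked outside an
event of probability `k * (k - 1) * (1 - δ ^ 4) ^ (k - 2)`. The core and its neighbours then lie in
one component. A vertex `i` outside it is stray: it has a neighbour, but none in the core. If the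
points outside the core carry at most `η` times the weight of the core, then `i` is stray with
probability at most `η` times its expected number of neighbours in the core, and the expected ratio
of the number of stray vertices to the size of the closed neighbourhood of the core is at most
`2 * η`. As `ν → ∞` the core grows linearly by concentration of the Poisson law, while the mean
weight outside it is `ν * ∫ |f| 1[|f| < δ]`, which for small `δ` is a small multiple of the weight
of the core.
-/

namespace KEG

section Graph

variable {V V' : Type*} {G : SimpleGraph V} {H : SimpleGraph V'} {K : Set V} {v w : V} {ε : ℝ≥0}

/-- The closed neighbourhood of a set of vertices `K`, the candidate for the giant component. -/
def hub (G : SimpleGraph V) (K : Set V) : Set V := {v | v ∈ K ∨ ∃ w ∈ K, G.Adj v w}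

/-- The non-isolated vertices outside the closed neighbourhood of `K`. -/
def stray (G : SimpleGraph V) (K : Set V) : Set V := G.support \ hub G K

/-- `K` is linked if any two of its vertices have a common neighbour in `K`. -/
def IsLinked (G : SimpleGraph V) (K : Set V) : Prop :=
  K.Pairwise fun v w => ∃ u ∈ K, G.Adj v u ∧ G.Adj w u

/-- `K` is linked, its closed neighbourhood is finite, and there are at most `ε` times as many
stray vertices. -/
structure HasGiantHub (G : SimpleGraph V) (K : Set V) (ε : ℝ≥0) : Prop where
  linked : IsLinked G K
  finite : (hub G K).Finite
  stray_le : ((stray G K).encard : ℝ≥0∞) ≤ ε * (hub G K).encard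

lemma IsLinked.reachable (hK : IsLinked G K) (hv : v ∈ hub G K) (hw : w ∈ hub G K) :
    G.Reachable v w := by
  have reachable_of_mem {a b : V} (ha : a ∈ K) (hb : b ∈ K) : G.Reachable a b := by
    rcases eq_or_ne a b with rfl | hab
    · rfl
    · obtain ⟨u, -, hau, hbu⟩ := hK ha hb hab
      exact hau.reachable.trans hbu.symm.reachable
  have attach {a : V} (ha : a ∈ hub G K) : ∃ b ∈ K, G.Reachable a b := by
    rcases ha with ha | ⟨b, hb, hab⟩
    exacts [⟨a, ha, .refl a⟩, ⟨b, hb, hab.reachable⟩]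
  obtain ⟨v', hv', hvv'⟩ := attach hv
  obtain ⟨w', hw', hww'⟩ := attach hw
  exact hvv'.trans ((reachable_of_mem hv' hw').trans hww'.symm)

lemma IsLinked.hub_subset_support (hK : IsLinked G K) (hn : K.Nontrivial) :
    hub G K ⊆ G.support := by
  rintro v (hv | ⟨w, -, hvw⟩)
  · obtain ⟨w, hw, hwv⟩ := hn.exists_ne v
    obtain ⟨u, -, hvu, -⟩ := hK hv hw hwv.symm
    exact ⟨u, hvu⟩
  · exact ⟨w, hvw⟩

lemma reachable_induce_support (h : G.Reachable v w) (hv : v ∈ G.support) (hw : w ∈ G.support) :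
    (G.induce G.support).Reachable ⟨v, hv⟩ ⟨w, hw⟩ := by
  obtain ⟨p⟩ := h
  induction p with
  | nil => rfl
  | @cons a b _ hab _ ih =>
    have step : (G.induce G.support).Adj ⟨a, hv⟩ ⟨b, a, hab.symm⟩ := hab
    exact step.reachable.trans (ih _ hw)

lemma largestComponentSize_le_of_hom (φ : G →g H) (hφ : Function.Injective φ) :
    largestComponentSize G ≤ largestComponentSize H := by
  refine iSup_le fun C => ?_
  rw [← hφ.encard_image]
  refine le_iSup_of_le (C.map φ) (Set.encard_le_encard ?_)
  rintro _ ⟨v, rfl, rfl⟩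
  rfl

lemma largestComponentSize_congr (φ : G ≃g H) :
    largestComponentSize G = largestComponentSize H :=
  le_antisymm (largestComponentSize_le_of_hom φ.toHom φ.injective)
    (largestComponentSize_le_of_hom φ.symm.toHom φ.symm.injective)

lemma largestComponentSize_le_encard_univ : largestComponentSize G ≤ (Set.univ : Set V).encard :=
  iSup_le fun _ => Set.encard_le_encard (Set.subset_univ _)

lemma IsLinked.encard_hub_le (hK : IsLinked G K) (hn : K.Nontrivial) :
    (hub G K).encard ≤ largestComponentSize (G.induce G.support) := by
  have hsub := hK.hub_subset_support hn
  obtain ⟨v, hv⟩ := hn.nonempty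
  have hv' : v ∈ hub G K := Or.inl hv
  refine le_iSup_of_le ((G.induce G.support).connectedComponentMk ⟨v, hsub hv'⟩) ?_
  rw [← Subtype.val_injective.encard_image]
  refine Set.encard_le_encard fun w hw => ⟨⟨w, hsub hw⟩, ?_, rfl⟩
  exact SimpleGraph.ConnectedComponent.sound
    (reachable_induce_support (hK.reachable hw hv') (hsub hw) (hsub hv'))

lemma HasGiantHub.encard_support_le (h : HasGiantHub G K ε) :
    (G.support.encard : ℝ≥0∞) ≤ (1 + ε) * (hub G K).encard := by
  have hsub : G.support ⊆ hub G K ∪ stray G K := by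
    rw [stray, Set.union_sdiff_self]
    exact Set.subset_union_right
  calc (G.support.encard : ℝ≥0∞)
      ≤ ((hub G K).encard + (stray G K).encard : ℕ∞) :=
        ENat.toENNReal_le.2 ((Set.encard_le_encard hsub).trans (Set.encard_union_le _ _))
    _ ≤ (hub G K).encard + ε * (hub G K).encard := by
        rw [ENat.toENNReal_add]
        gcongr
        exact h.stray_le
    _ = (1 + ε) * (hub G K).encard := by ring

lemma HasGiantHub.finite_support (h : HasGiantHub G K ε) : G.support.Finite := by
  rw [← Set.encard_lt_top_iff, ← ENat.toENNReal_lt_top]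
  refine h.encard_support_le.trans_lt (ENNReal.mul_lt_top (by finiteness) ?_)
  rw [ENat.toENNReal_lt_top, Set.encard_lt_top_iff]
  exact h.finite

theorem HasGiantHub.lt_largestComponentSize (h : HasGiantHub G K ε) (hn : K.Nontrivial)
    (hε : 0 < ε) : (1 - ε : ℝ) * G.support.ncard <
      (largestComponentSize (G.induce G.support)).toNat := by
  have hfin := h.finite_support
  have hub_pos : 0 < (hub G K).ncard :=
    (Set.ncard_pos h.finite).2 (hn.nonempty.mono fun _ => Or.inl)
  have support_le : (G.support.ncard : ℝ) ≤ (1 + ε) * (hub G K).ncard := by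
    have key := h.encard_support_le
    rw [← hfin.cast_ncard_eq, ← h.finite.cast_ncard_eq, ENat.toENNReal_coe,
      ENat.toENNReal_coe] at key
    exact_mod_cast key
  have hub_le : ((hub G K).ncard : ℝ) ≤
      (largestComponentSize (G.induce G.support)).toNat := by
    have htop : largestComponentSize (G.induce G.support) ≠ ⊤ :=
      ne_top_of_le_ne_top (Set.encard_ne_top_iff.2 (@Set.finite_univ _ hfin))
        largestComponentSize_le_encard_univ
    exact_mod_cast ENat.toNat_le_toNat (h.linked.encard_hub_le hn) htop
  refine lt_of_lt_of_le ?_ hub_le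
  have hub_pos' : (0 : ℝ) < (hub G K).ncard := by exact_mod_cast hub_pos
  have hε' : (0 : ℝ) < ε := by exact_mod_cast hε
  rcases le_total (ε : ℝ) 1 with h1 | h1
  · nlinarith [mul_le_mul_of_nonneg_left support_le (sub_nonneg.2 h1), mul_pos hub_pos' hε',
      mul_pos (mul_pos hub_pos' hε') hε']
  · nlinarith [mul_nonneg (sub_nonneg.2 h1) (Nat.cast_nonneg (α := ℝ) G.support.ncard)]

end Graph

section Measurability

lemma encard_eq_tsum {ι : Type*} (S : Set ι) : (S.encard : ℝ≥0∞) = ∑' i, S.indicator 1 i := by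
  rw [← ENNReal.tsum_set_one, tsum_subtype S (fun _ => (1 : ℝ≥0∞))]
  rfl

variable {Ω ι : Type*} [MeasurableSpace Ω] [Countable ι] {P : Measure Ω}
  {G : Ω → SimpleGraph ι} {K : Ω → Set ι}

lemma measurable_hub (hG : ∀ i j, Measurable fun ω => (G ω).Adj i j) (hK : Measurable K) :
    Measurable fun ω => hub (G ω) (K ω) := by
  rw [measurable_set_iff] at hK ⊢
  intro i
  exact (hK i).or (Measurable.exists fun j => (hK j).and (hG i j))

lemma measurable_stray (hG : ∀ i j, Measurable fun ω => (G ω).Adj i j) (hK : Measurable K) :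
    Measurable fun ω => stray (G ω) (K ω) := by
  have hhub := measurable_set_iff.1 (measurable_hub hG hK)
  rw [measurable_set_iff]
  intro i
  exact (Measurable.exists fun j => hG i j).and (hhub i).not

lemma measurable_encard_toENNReal {S : Ω → Set ι} (hS : Measurable S) :
    Measurable fun ω => ((S ω).encard : ℝ≥0∞) :=
  (Measurable.of_discrete (f := ENat.toENNReal)).comp (measurable_encard.comp hS)

lemma measurable_hasGiantHub (hG : ∀ i j, Measurable fun ω => (G ω).Adj i j) (hK : Measurable K)
    (ε : ℝ≥0) : Measurable fun ω => HasGiantHub (G ω) (K ω) ε := by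
  have hhub := measurable_hub hG hK
  have hlinked : Measurable fun ω => IsLinked (G ω) (K ω) := by
    have hK' := measurable_set_iff.1 hK
    exact Measurable.forall fun i => (hK' i).imp <| Measurable.forall fun j => (hK' j).imp <|
      measurable_const.imp <| Measurable.exists fun u => (hK' u).and ((hG i u).and (hG j u))
  have hfin : Measurable fun ω => (hub (G ω) (K ω)).Finite := by
    simp only [← Set.encard_lt_top_iff]
    exact (Measurable.of_discrete (f := (· < (⊤ : ℕ∞)))).comp (measurable_encard.comp hhub)
  have hstray : Measurable fun ω =>
      ((stray (G ω) (K ω)).encard : ℝ≥0∞) ≤ ε * (hub (G ω) (K ω)).encard :=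
    measurableSet_setOfPred.1 (measurableSet_le
      (measurable_encard_toENNReal (measurable_stray hG hK))
      ((measurable_encard_toENNReal hhub).const_mul _))
  have hiff (ω : Ω) : HasGiantHub (G ω) (K ω) ε ↔ IsLinked (G ω) (K ω) ∧
      (hub (G ω) (K ω)).Finite ∧
      ((stray (G ω) (K ω)).encard : ℝ≥0∞) ≤ ε * (hub (G ω) (K ω)).encard :=
    ⟨fun h => ⟨h.1, h.2, h.3⟩, fun h => ⟨h.1, h.2.1, h.2.2⟩⟩
  simp only [hiff]
  exact hlinked.and (hfin.and hstray)

end Measurability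

section IndependentEdges

lemma one_add_sum_mul_prod_le_one {ι R : Type*} [CommSemiring R] [PartialOrder R]
    [IsOrderedRing R] (s : Finset ι) {p q : ι → R} (hp : ∀ i, 0 ≤ p i) (hq : ∀ i, 0 ≤ q i)
    (hpq : ∀ i, p i + q i = 1) : (1 + ∑ i ∈ s, p i) * ∏ i ∈ s, q i ≤ 1 := by
  induction s using Finset.cons_induction with
  | empty => simp
  | cons a s has ih =>
    have hprod : ∏ i ∈ s, q i ≤ 1 :=
      Finset.prod_le_one (fun i _ => hq i) fun i _ => hpq i ▸ le_add_of_nonneg_left (hp i)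
    have hqa : q a ≤ 1 := hpq a ▸ le_add_of_nonneg_left (hp a)
    rw [Finset.sum_cons, Finset.prod_cons]
    calc (1 + (p a + ∑ i ∈ s, p i)) * (q a * ∏ i ∈ s, q i)
        = q a * ((1 + ∑ i ∈ s, p i) * ∏ i ∈ s, q i) + p a * (q a * ∏ i ∈ s, q i) := by ring
      _ ≤ q a * 1 + p a * 1 := by
        gcongr
        · exact hq a
        · exact hp a
        · exact mul_le_one₀ hqa (Finset.prod_nonneg fun i _ => hq i) hprod
      _ = 1 := by rw [mul_one, mul_one, add_comm, hpq a]

variable {Ω ι : Type*} {E : Sym2 ι → Set Ω}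

/-- The random graph in which the pair `e` is an edge when the event `E e` occurs. Events indexed
by the diagonal are ignored. -/
def edgeGraph (E : Sym2 ι → Set Ω) (ω : Ω) : SimpleGraph ι := SimpleGraph.fromEdgeSet {e | ω ∈ E e}

/-- The σ-algebra of the events that depend only on the edges in `S`. -/
abbrev edgeSigma (E : Sym2 ι → Set Ω) (S : Set (Sym2 ι)) : MeasurableSpace Ω :=
  MeasurableSpace.generateFrom {t | ∃ e ∈ S, E e = t}

lemma edgeGraph_adj {ω : Ω} {i j : ι} : (edgeGraph E ω).Adj i j ↔ ω ∈ E s(i, j) ∧ i ≠ j := by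
  simp [edgeGraph]

lemma measurable_edgeSigma_mem {S : Set (Sym2 ι)} {e : Sym2 ι} (he : e ∈ S) :
    Measurable[edgeSigma E S] fun ω => ω ∈ E e := by
  let _ := edgeSigma E S
  exact measurableSet_setOfPred.1 (MeasurableSpace.measurableSet_generateFrom ⟨e, he, rfl⟩)

lemma measurable_edgeSigma_adj {S : Set (Sym2 ι)} {i j : ι} (h : i ≠ j → s(i, j) ∈ S) :
    Measurable[edgeSigma E S] fun ω => (edgeGraph E ω).Adj i j := by
  let _ := edgeSigma E S
  simp only [edgeGraph_adj]
  by_cases hij : i = j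
  · simp [hij]
  · simp only [hij, ne_eq, not_false_eq_true, and_true]
    exact measurable_edgeSigma_mem (h hij)

lemma measurable_edgeSigma_mem_hub [Countable ι] {S : Set (Sym2 ι)} {K : Set ι} {i : ι}
    (h : ∀ j ∈ K, i ≠ j → s(i, j) ∈ S) :
    Measurable[edgeSigma E S] fun ω => i ∈ hub (edgeGraph E ω) K := by
  let _ := edgeSigma E S
  have hiff (ω : Ω) : i ∈ hub (edgeGraph E ω) K ↔ i ∈ K ∨ ∃ j : K, (edgeGraph E ω).Adj i j := by
    simp [hub]
  simp only [hiff]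
  exact measurable_const.or (Measurable.exists fun j => measurable_edgeSigma_adj (h j j.2))

variable [MeasurableSpace Ω] {P : Measure Ω}

lemma edgeSigma_le (hE : ∀ e, MeasurableSet (E e)) (S : Set (Sym2 ι)) :
    edgeSigma E S ≤ ‹MeasurableSpace Ω› := by
  refine MeasurableSpace.generateFrom_le ?_
  rintro _ ⟨e, -, rfl⟩
  exact hE e

lemma measurable_adj (hE : ∀ e, MeasurableSet (E e)) (i j : ι) :
    Measurable fun ω => (edgeGraph E ω).Adj i j :=
  (measurable_edgeSigma_adj (S := Set.univ) fun _ => Set.mem_univ _).mono (edgeSigma_le hE _) le_rfl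

lemma measure_and_of_disjoint (hE : ∀ e, MeasurableSet (E e)) (hi : iIndepSet E P)
    {S T : Set (Sym2 ι)} (hST : Disjoint S T) {p q : Ω → Prop}
    (hp : Measurable[edgeSigma E S] p) (hq : Measurable[edgeSigma E T] q) :
    P {ω | p ω ∧ q ω} = P {ω | p ω} * P {ω | q ω} :=
  (Indep_iff _ _ P).1 (hi.indep_generateFrom_of_disjoint hE S T hST) _ _
    ((@measurableSet_setOfPred _ (edgeSigma E S) _).2 hp)
    ((@measurableSet_setOfPred _ (edgeSigma E T) _).2 hq)

lemma measure_adj (i j : ι) (hij : i ≠ j) : P {ω | (edgeGraph E ω).Adj i j} = P (E s(i, j)) := by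
  congr 1 with ω
  simp [edgeGraph_adj, hij]

lemma measure_adj_and (hE : ∀ e, MeasurableSet (E e)) (hi : iIndepSet E P) {i j u : ι}
    (hij : i ≠ j) (hiu : i ≠ u) (hju : j ≠ u) :
    P {ω | (edgeGraph E ω).Adj i u ∧ (edgeGraph E ω).Adj j u} =
      P (E s(i, u)) * P (E s(j, u)) := by
  have hd : Disjoint {s(i, u)} ({s(j, u)} : Set (Sym2 ι)) := by simp [hij, hiu]
  rw [measure_and_of_disjoint hE hi hd (measurable_edgeSigma_adj fun _ => rfl)
    (measurable_edgeSigma_adj fun _ => rfl), measure_adj i u hiu, measure_adj j u hju]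

lemma measure_notMem_hub (hE : ∀ e, MeasurableSet (E e)) (hi : iIndepSet E P) {K : Finset ι}
    {i : ι} (hiK : i ∉ K) :
    P {ω | i ∉ hub (edgeGraph E ω) K} = ∏ j ∈ K, (1 - P (E s(i, j))) := by
  have := hi.isProbabilityMeasure
  have hinj : Function.Injective fun j => s(i, j) := fun _ _ h => Sym2.congr_right.1 h
  have hset : {ω | i ∉ hub (edgeGraph E ω) K} = ⋂ j ∈ K, (E s(i, j))ᶜ := by
    ext ω
    simp only [hub, Finset.mem_coe, hiK, edgeGraph_adj, false_or, Set.mem_ofPred_eq, not_exists,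
      not_and, not_not, Set.mem_iInter, Set.mem_compl_iff]
    exact forall₂_congr fun j hj => ⟨fun h hω => hiK (h hω ▸ hj), fun h hω => absurd hω h⟩
  have hcompl (j : ι) : MeasurableSet[MeasurableSpace.generateFrom {E s(i, j)}] (E s(i, j))ᶜ :=
    (MeasurableSpace.measurableSet_generateFrom (Set.mem_singleton _)).compl
  rw [hset, ((iIndepSet_iff_iIndep _ _).1 (hi.precomp hinj)).meas_biInter fun j _ => hcompl j]
  exact Finset.prod_congr rfl fun j _ => prob_compl_eq_one_sub (hE _)

variable [Countable ι]

lemma measure_no_common_neighbour_le (hE : ∀ e, MeasurableSet (E e)) (hi : iIndepSet E P)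
    {i j : ι} (hij : i ≠ j) {q : ℝ≥0∞} (s : Finset ι) (his : i ∉ s) (hjs : j ∉ s)
    (hqi : ∀ u ∈ s, q ≤ P (E s(i, u))) (hqj : ∀ u ∈ s, q ≤ P (E s(j, u))) :
    P {ω | ∀ u ∈ s, ¬((edgeGraph E ω).Adj i u ∧ (edgeGraph E ω).Adj j u)} ≤
      (1 - q ^ 2) ^ s.card := by
  have := hi.isProbabilityMeasure
  induction s using Finset.cons_induction with
  | empty => simp
  | cons a s has ih =>
    simp only [Finset.mem_cons, not_or, forall_eq_or_imp] at his hjs hqi hqj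
    let S : Set (Sym2 ι) := {s(i, a), s(j, a)}
    let T : Set (Sym2 ι) := {e | ∃ u ∈ s, e = s(i, u) ∨ e = s(j, u)}
    have hST : Disjoint S T := by
      rw [Set.disjoint_left]
      rintro e he ⟨u, hu, he'⟩
      have hau : a ≠ u := fun h => has (h ▸ hu)
      rcases he with rfl | rfl <;> rcases he' with he' | he' <;>
        simp [hau, hij, hij.symm, Ne.symm his.1, Ne.symm hjs.1] at he'
    have hA : Measurable[edgeSigma E S]
        fun ω => ¬((edgeGraph E ω).Adj i a ∧ (edgeGraph E ω).Adj j a) := by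
      let _ := edgeSigma E S
      exact ((measurable_edgeSigma_adj fun _ => by simp [S]).and
        (measurable_edgeSigma_adj fun _ => by simp [S])).not
    have hB : Measurable[edgeSigma E T]
        fun ω => ∀ u ∈ s, ¬((edgeGraph E ω).Adj i u ∧ (edgeGraph E ω).Adj j u) := by
      let _ := edgeSigma E T
      refine Measurable.forall fun u => Measurable.forall fun hu => Measurable.not ?_
      have hiT : s(i, u) ∈ T := ⟨u, hu, Or.inl rfl⟩
      have hjT : s(j, u) ∈ T := ⟨u, hu, Or.inr rfl⟩
      exact (measurable_edgeSigma_adj fun _ => hiT).and (measurable_edgeSigma_adj fun _ => hjT)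
    have hAq : P {ω | ¬((edgeGraph E ω).Adj i a ∧ (edgeGraph E ω).Adj j a)} ≤ 1 - q ^ 2 := by
      have hadj := (measurable_adj hE i a).and (measurable_adj hE j a)
      refine (prob_compl_eq_one_sub (measurableSet_setOfPred.2 hadj)).trans_le ?_
      rw [measure_adj_and hE hi hij his.1 hjs.1, sq]
      gcongr
      exacts [hqi.1, hqj.1]
    simp only [Finset.mem_cons, forall_eq_or_imp]
    rw [measure_and_of_disjoint hE hi hST hA hB, Finset.card_cons, pow_succ' (1 - q ^ 2)]
    exact mul_le_mul' hAq (ih his.2 hjs.2 hqi.2 hqj.2)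

theorem measure_not_isLinked_le (hE : ∀ e, MeasurableSet (E e)) (hi : iIndepSet E P)
    (K : Finset ι) {q : ℝ≥0∞} (hq : ∀ i ∈ K, ∀ j ∈ K, i ≠ j → q ≤ P (E s(i, j))) :
    P {ω | ¬IsLinked (edgeGraph E ω) K} ≤
      K.card.descFactorial 2 * (1 - q ^ 2) ^ (K.card - 2) := by
  classical
  have hsub : {ω | ¬IsLinked (edgeGraph E ω) K} ⊆ ⋃ p ∈ K.offDiag,
      {ω | ∀ u ∈ (K.erase p.1).erase p.2,
        ¬((edgeGraph E ω).Adj p.1 u ∧ (edgeGraph E ω).Adj p.2 u)} := by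
    intro ω hω
    simp only [IsLinked, Set.Pairwise, Set.mem_ofPred_eq] at hω
    push Not at hω
    obtain ⟨i, hiK, j, hjK, hij, hω⟩ := hω
    simp only [Set.mem_iUnion, Set.mem_ofPred_eq, Finset.mem_offDiag]
    exact ⟨(i, j), ⟨hiK, hjK, hij⟩,
      fun u hu h => hω u (Finset.mem_of_mem_erase (Finset.mem_of_mem_erase hu)) h.1 h.2⟩
  have hpair {p : ι × ι} (hp : p ∈ K.offDiag) :
      P {ω | ∀ u ∈ (K.erase p.1).erase p.2,
        ¬((edgeGraph E ω).Adj p.1 u ∧ (edgeGraph E ω).Adj p.2 u)} ≤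
      (1 - q ^ 2) ^ (K.card - 2) := by
    obtain ⟨hi1, hi2, hne⟩ := Finset.mem_offDiag.1 hp
    have hcard : ((K.erase p.1).erase p.2).card = K.card - 2 := by
      rw [Finset.card_erase_of_mem (Finset.mem_erase.2 ⟨hne.symm, hi2⟩),
        Finset.card_erase_of_mem hi1, Nat.sub_sub]
    rw [← hcard]
    refine measure_no_common_neighbour_le hE hi hne _ (by simp) (by simp) ?_ ?_
    · simp only [Finset.mem_erase]
      exact fun u hu => hq _ hi1 _ hu.2.2 hu.2.1.symm
    · simp only [Finset.mem_erase]
      exact fun u hu => hq _ hi2 _ hu.2.2 hu.1.symm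
  calc P {ω | ¬IsLinked (edgeGraph E ω) K}
      ≤ ∑ _p ∈ K.offDiag, (1 - q ^ 2) ^ (K.card - 2) :=
        (measure_mono hsub).trans ((measure_biUnion_finset_le _ _).trans
          (Finset.sum_le_sum fun p hp => hpair hp))
    _ = K.card.descFactorial 2 * (1 - q ^ 2) ^ (K.card - 2) := by
        have : K.card * (K.card - 1) = (K.card - 1) * K.card := mul_comm _ _
        rw [Finset.sum_const, Finset.offDiag_card, nsmul_eq_mul]
        simp [Nat.descFactorial, ← this, Nat.mul_sub]

lemma sum_mul_measure_notMem_hub_le (hE : ∀ e, MeasurableSet (E e)) (hi : iIndepSet E P)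
    {K : Finset ι} {i : ι} (hiK : i ∉ K) :
    (∑ j ∈ K, P (E s(i, j))) * P {ω | i ∉ hub (edgeGraph E ω) K} ≤
      P {ω | i ∈ hub (edgeGraph E ω) K} := by
  have := hi.isProbabilityMeasure
  have hmeas : MeasurableSet {ω | i ∈ hub (edgeGraph E ω) K} := measurableSet_setOfPred.2
    (measurable_set_iff.1 (measurable_hub (measurable_adj hE) measurable_const) i)
  have hone : P {ω | i ∈ hub (edgeGraph E ω) K} + P {ω | i ∉ hub (edgeGraph E ω) K} = 1 :=
    prob_add_prob_compl hmeas
  have hle := one_add_sum_mul_prod_le_one K (p := fun j => P (E s(i, j)))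
    (q := fun j => 1 - P (E s(i, j))) (fun _ => zero_le) (fun _ => zero_le)
    fun j => add_tsub_cancel_of_le prob_le_one
  rw [← measure_notMem_hub hE hi hiK, add_mul, one_mul, ← hone, add_comm] at hle
  exact (ENNReal.add_le_add_iff_right (measure_ne_top P _)).1 hle

lemma measure_mem_stray_le (hE : ∀ e, MeasurableSet (E e)) (hi : iIndepSet E P)
    {K : Finset ι} {i : ι} (hiK : i ∉ K) :
    P {ω | i ∈ stray (edgeGraph E ω) K} ≤ P {ω | i ∉ hub (edgeGraph E ω) K} *
      ∑' l : ↥(insert i (K : Set ι))ᶜ, P (E s(i, l)) := by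
  let L : Set ι := (insert i (K : Set ι))ᶜ
  have hsub : {ω | i ∈ stray (edgeGraph E ω) K} ⊆
      {ω | i ∉ hub (edgeGraph E ω) K ∧ ∃ l : L, ω ∈ E s(i, l)} := by
    rintro ω ⟨⟨l, hil : (edgeGraph E ω).Adj i l⟩, hhub⟩
    have hl : l ∈ L := by
      rintro (rfl | hlK)
      exacts [hil.ne rfl, hhub (Or.inr ⟨l, hlK, hil⟩)]
    exact ⟨hhub, ⟨l, hl⟩, (edgeGraph_adj.1 hil).1⟩
  let S : Set (Sym2 ι) := (fun j => s(i, j)) '' K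
  let T : Set (Sym2 ι) := (fun j => s(i, j)) '' L
  have hST : Disjoint S T := by
    rw [Set.disjoint_image_iff fun _ _ h => Sym2.congr_right.1 h]
    exact Set.disjoint_compl_right_iff_subset.2 (Set.subset_insert _ _)
  have hS : Measurable[edgeSigma E S] fun ω => i ∉ hub (edgeGraph E ω) K := by
    let _ := edgeSigma E S
    exact (measurable_edgeSigma_mem_hub fun j hj _ => Set.mem_image_of_mem _ hj).not
  have hT : Measurable[edgeSigma E T] fun ω => ∃ l : L, ω ∈ E s(i, l) := by
    let _ := edgeSigma E T
    exact Measurable.exists fun l => measurable_edgeSigma_mem (Set.mem_image_of_mem _ l.2)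
  refine (measure_mono hsub).trans ?_
  rw [measure_and_of_disjoint hE hi hST hS hT, Set.ofPred_exists]
  gcongr
  exact measure_iUnion_le _

lemma inv_encard_sdiff_singleton_le {ι : Type*} {i : ι} {S : Set ι} (h : (S \ {i}).Nonempty) :
    ((S \ {i}).encard : ℝ≥0∞)⁻¹ ≤ 2 * (S.encard : ℝ≥0∞)⁻¹ := by
  have hle : (S.encard : ℝ≥0∞) ≤ 2 * (S \ {i}).encard := by
    have h1 : S.encard ≤ (S \ {i}).encard + 1 := by
      simpa using Set.encard_le_encard_sdiff_add_encard S {i}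
    have h2 : 1 ≤ (S \ {i}).encard := Set.one_le_encard_iff_nonempty.2 h
    calc (S.encard : ℝ≥0∞) ≤ ((S \ {i}).encard + (S \ {i}).encard : ℕ∞) :=
          ENat.toENNReal_le.2 (h1.trans (by gcongr))
      _ = 2 * (S \ {i}).encard := by rw [ENat.toENNReal_add, two_mul]
  rw [← ENNReal.inv_le_inv, ENNReal.mul_inv (by simp) (by simp)] at hle
  calc ((S \ {i}).encard : ℝ≥0∞)⁻¹ = 2 * (2⁻¹ * ((S \ {i}).encard : ℝ≥0∞)⁻¹) := by
        rw [← mul_assoc, ENNReal.mul_inv_cancel (by simp) (by simp), one_mul]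
    _ ≤ 2 * (S.encard : ℝ≥0∞)⁻¹ := by gcongr

variable {K : Finset ι} {i : ι}

lemma lintegral_indicator_mul_inv_encard_erase (hE : ∀ e, MeasurableSet (E e))
    (hi : iIndepSet E P) {p : Ω → Prop} (hp : Measurable[edgeSigma E {e | i ∈ e}] p)
    (hiK : i ∉ K) :
    ∫⁻ ω, {ω | p ω}.indicator 1 ω * ((hub (edgeGraph E ω) K \ {i}).encard : ℝ≥0∞)⁻¹ ∂P =
      P {ω | p ω} * ∫⁻ ω, ((hub (edgeGraph E ω) K \ {i}).encard : ℝ≥0∞)⁻¹ ∂P := by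
  have hd : Disjoint {e : Sym2 ι | i ∈ e} {e | i ∉ e} := disjoint_compl_right
  have hf : Measurable[edgeSigma E {e | i ∈ e}] ({ω | p ω}.indicator (1 : Ω → ℝ≥0∞)) := by
    let _ := edgeSigma E {e | i ∈ e}
    exact measurable_one.indicator (measurableSet_setOfPred.2 hp)
  have hg : Measurable[edgeSigma E {e | i ∉ e}] fun ω =>
      ((hub (edgeGraph E ω) K \ {i}).encard : ℝ≥0∞)⁻¹ := by
    let _ := edgeSigma E {e | i ∉ e}
    refine (measurable_encard_toENNReal (measurable_set_iff.2 fun j => ?_)).inv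
    rcases eq_or_ne j i with rfl | hj
    · simp
    · simp only [Set.mem_sdiff, Set.mem_singleton_iff, hj, not_false_eq_true, and_true]
      refine measurable_edgeSigma_mem_hub fun k hk _ => ?_
      have hki : k ≠ i := fun h => hiK (h ▸ hk)
      simp [hj.symm, hki.symm]
  rw [lintegral_mul_eq_lintegral_mul_lintegral_of_independent_measurableSpace (edgeSigma_le hE _)
    (edgeSigma_le hE _) (hi.indep_generateFrom_of_disjoint hE _ _ hd) hf hg,
    lintegral_indicator_one]
  exact edgeSigma_le hE _ _ ((@measurableSet_setOfPred _ (edgeSigma E {e | i ∈ e}) _).2 hp)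

-- Leave-one-out: the number of hub vertices other than `i` does not depend on the edges at `i`.
lemma lintegral_stray_mem_div_hub_le (hE : ∀ e, MeasurableSet (E e)) (hi : iIndepSet E P)
    {η : ℝ≥0∞} (hiK : i ∉ K)
    (hη : ∑' l : ↥(insert i (K : Set ι))ᶜ, P (E s(i, l)) ≤ η * ∑ j ∈ K, P (E s(i, j))) :
    ∫⁻ ω, (stray (edgeGraph E ω) K).indicator 1 i * ((hub (edgeGraph E ω) K).encard : ℝ≥0∞)⁻¹ ∂P ≤
      2 * η * ∫⁻ ω, (hub (edgeGraph E ω) K).indicator 1 i *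
        ((hub (edgeGraph E ω) K).encard : ℝ≥0∞)⁻¹ ∂P := by
  let R (ω : Ω) : ℝ≥0∞ := ((hub (edgeGraph E ω) K \ {i}).encard : ℝ≥0∞)⁻¹
  have hhub : Measurable[edgeSigma E {e | i ∈ e}] fun ω => i ∈ hub (edgeGraph E ω) K :=
    measurable_edgeSigma_mem_hub fun j _ _ => Sym2.mem_mk_left i j
  have hstray : Measurable[edgeSigma E {e | i ∈ e}] fun ω => i ∈ stray (edgeGraph E ω) K := by
    let _ := edgeSigma E {e | i ∈ e}
    exact (Measurable.exists fun j => measurable_edgeSigma_adj fun _ => Sym2.mem_mk_left i j).and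
      hhub.not
  have hR_hub (ω : Ω) : (hub (edgeGraph E ω) K).indicator 1 i * R ω ≤
      2 * ((hub (edgeGraph E ω) K).indicator 1 i * ((hub (edgeGraph E ω) K).encard : ℝ≥0∞)⁻¹) := by
    by_cases hmem : i ∈ hub (edgeGraph E ω) K
    · obtain ⟨j, hjK, hij⟩ := hmem.resolve_left hiK
      simp only [Set.indicator_of_mem hmem, Pi.one_apply, one_mul]
      exact inv_encard_sdiff_singleton_le ⟨j, Or.inl hjK, hij.ne'⟩
    · simp [Set.indicator_of_notMem hmem]
  have hR_stray (ω : Ω) :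
      (stray (edgeGraph E ω) K).indicator 1 i * ((hub (edgeGraph E ω) K).encard : ℝ≥0∞)⁻¹ ≤
        (stray (edgeGraph E ω) K).indicator 1 i * R ω := by
    refine mul_le_mul_right (ENNReal.inv_le_inv.2 (ENat.toENNReal_le.2 ?_)) _
    exact Set.encard_le_encard Set.sdiff_subset
  calc ∫⁻ ω, (stray (edgeGraph E ω) K).indicator 1 i * ((hub (edgeGraph E ω) K).encard : ℝ≥0∞)⁻¹ ∂P
      ≤ ∫⁻ ω, (stray (edgeGraph E ω) K).indicator 1 i * R ω ∂P := lintegral_mono hR_stray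
    _ = P {ω | i ∈ stray (edgeGraph E ω) K} * ∫⁻ ω, R ω ∂P :=
        lintegral_indicator_mul_inv_encard_erase hE hi hstray hiK
    _ ≤ (P {ω | i ∉ hub (edgeGraph E ω) K} * (η * ∑ j ∈ K, P (E s(i, j)))) * ∫⁻ ω, R ω ∂P := by
        gcongr
        exact (measure_mem_stray_le hE hi hiK).trans (by gcongr)
    _ = η * (((∑ j ∈ K, P (E s(i, j))) * P {ω | i ∉ hub (edgeGraph E ω) K}) * ∫⁻ ω, R ω ∂P) := by
        ring
    _ ≤ η * (P {ω | i ∈ hub (edgeGraph E ω) K} * ∫⁻ ω, R ω ∂P) := by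
        gcongr
        exact sum_mul_measure_notMem_hub_le hE hi hiK
    _ = η * ∫⁻ ω, (hub (edgeGraph E ω) K).indicator 1 i * R ω ∂P := by
        congr 1
        exact (lintegral_indicator_mul_inv_encard_erase hE hi hhub hiK).symm
    _ ≤ η * ∫⁻ ω, 2 * ((hub (edgeGraph E ω) K).indicator 1 i *
          ((hub (edgeGraph E ω) K).encard : ℝ≥0∞)⁻¹) ∂P := by
        exact mul_le_mul_right (lintegral_mono hR_hub) _
    _ = 2 * η * ∫⁻ ω, (hub (edgeGraph E ω) K).indicator 1 i *
          ((hub (edgeGraph E ω) K).encard : ℝ≥0∞)⁻¹ ∂P := by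
        rw [lintegral_const_mul' _ _ (by simp)]
        ring

theorem lintegral_encard_stray_div_encard_hub_le (hE : ∀ e, MeasurableSet (E e))
    (hi : iIndepSet E P) {η : ℝ≥0∞} (hη : ∀ i ∉ K,
      ∑' l : ↥(insert i (K : Set ι))ᶜ, P (E s(i, l)) ≤ η * ∑ j ∈ K, P (E s(i, j))) :
    ∫⁻ ω, (stray (edgeGraph E ω) K).encard / (hub (edgeGraph E ω) K).encard ∂P ≤ 2 * η := by
  have := hi.isProbabilityMeasure
  have hmeas {S : Ω → Set ι} (hS : Measurable S) (i : ι) : AEMeasurable (fun ω =>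
      (S ω).indicator 1 i * ((hub (edgeGraph E ω) K).encard : ℝ≥0∞)⁻¹) P := by
    have hind : Measurable fun ω => (S ω).indicator (1 : ι → ℝ≥0∞) i :=
      measurable_one.indicator (measurableSet_setOfPred.2 (measurable_set_iff.1 hS i))
    exact (hind.mul (measurable_encard_toENNReal
      (measurable_hub (measurable_adj hE) measurable_const)).inv).aemeasurable
  have hvertex (i : ι) :
      ∫⁻ ω, (stray (edgeGraph E ω) K).indicator 1 i *
          ((hub (edgeGraph E ω) K).encard : ℝ≥0∞)⁻¹ ∂P ≤
        2 * η * ∫⁻ ω, (hub (edgeGraph E ω) K).indicator 1 i *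
          ((hub (edgeGraph E ω) K).encard : ℝ≥0∞)⁻¹ ∂P := by
    by_cases hiK : i ∈ K
    · have hstray (ω : Ω) : i ∉ stray (edgeGraph E ω) K := fun h => h.2 (Or.inl hiK)
      simp [hstray]
    · exact lintegral_stray_mem_div_hub_le hE hi hiK (hη i hiK)
  simp_rw [div_eq_mul_inv, encard_eq_tsum (stray _ _), ← ENNReal.tsum_mul_right]
  rw [lintegral_tsum (hmeas (measurable_stray (measurable_adj hE) measurable_const))]
  refine (ENNReal.tsum_le_tsum hvertex).trans ?_
  rw [ENNReal.tsum_mul_left,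
    ← lintegral_tsum (hmeas (measurable_hub (measurable_adj hE) measurable_const))]
  simp_rw [ENNReal.tsum_mul_right, ← encard_eq_tsum, ← div_eq_mul_inv]
  calc 2 * η * ∫⁻ ω, (hub (edgeGraph E ω) K).encard / (hub (edgeGraph E ω) K).encard ∂P
      ≤ 2 * η * ∫⁻ _, 1 ∂P := by
        gcongr
        exact ENNReal.div_self_le_one
    _ = 2 * η := by simp

lemma ae_finite_hub (hsum : ∀ j ∈ K, ∑' i, P (E s(i, j)) ≠ ⊤) :
    ∀ᵐ ω ∂P, (hub (edgeGraph E ω) K).Finite := by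
  have hfin : ∀ᵐ ω ∂P, ∀ j ∈ K, {i | ω ∈ E s(i, j)}.Finite :=
    (ae_ball_iff K.countable_toSet).2 fun j hj => ae_finite_setOfPred_mem (hsum j hj)
  filter_upwards [hfin] with ω hω
  refine (K.finite_toSet.union (K.finite_toSet.biUnion hω)).subset ?_
  rintro i (hiK | ⟨j, hjK, hij⟩)
  · exact Or.inl hiK
  · exact Or.inr (Set.mem_biUnion hjK (edgeGraph_adj.1 hij).1)

theorem measure_not_hasGiantHub_le (hE : ∀ e, MeasurableSet (E e)) (hi : iIndepSet E P)
    {q η : ℝ≥0∞} {ε : ℝ≥0} (hε : 0 < ε) (hsum : ∀ j ∈ K, ∑' i, P (E s(i, j)) ≠ ⊤)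
    (hq : ∀ i ∈ K, ∀ j ∈ K, i ≠ j → q ≤ P (E s(i, j)))
    (hη : ∀ i ∉ K, ∑' l : ↥(insert i (K : Set ι))ᶜ, P (E s(i, l)) ≤ η * ∑ j ∈ K, P (E s(i, j))) :
    P {ω | ¬HasGiantHub (edgeGraph E ω) K ε} ≤
      K.card.descFactorial 2 * (1 - q ^ 2) ^ (K.card - 2) + 2 * η / ε := by
  have hsub : {ω | ¬HasGiantHub (edgeGraph E ω) K ε} ≤ᵐ[P]
      ({ω | ¬IsLinked (edgeGraph E ω) K} ∪ {ω | (ε : ℝ≥0∞) ≤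
        (stray (edgeGraph E ω) K).encard / (hub (edgeGraph E ω) K).encard} : Set Ω) := by
    filter_upwards [ae_finite_hub hsum] with ω hfin hω
    by_contra hgood
    obtain ⟨hlinked, hratio⟩ := not_or.1 hgood
    have hhub : ((hub (edgeGraph E ω) K).encard : ℝ≥0∞) ≠ ⊤ :=
      ENat.toENNReal_ne_top.2 (Set.encard_ne_top_iff.2 hfin)
    refine hω ⟨not_not.1 hlinked, hfin, le_of_not_gt fun hlt => hratio ?_⟩
    exact (ENNReal.le_div_iff_mul_le (Or.inr hlt.ne_bot) (Or.inl hhub)).2 hlt.le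
  have hmeas : Measurable fun ω =>
      ((stray (edgeGraph E ω) K).encard / (hub (edgeGraph E ω) K).encard : ℝ≥0∞) :=
    (measurable_encard_toENNReal (measurable_stray (measurable_adj hE) measurable_const)).div
      (measurable_encard_toENNReal (measurable_hub (measurable_adj hE) measurable_const))
  calc P {ω | ¬HasGiantHub (edgeGraph E ω) K ε}
      ≤ P {ω | ¬IsLinked (edgeGraph E ω) K} + P {ω | (ε : ℝ≥0∞) ≤
          (stray (edgeGraph E ω) K).encard / (hub (edgeGraph E ω) K).encard} :=
        (measure_mono_ae hsub).trans (measure_union_le _ _)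
    _ ≤ K.card.descFactorial 2 * (1 - q ^ 2) ^ (K.card - 2) + 2 * η / ε := by
        gcongr
        · exact measure_not_isLinked_le hE hi K hq
        · refine (meas_ge_le_lintegral_div hmeas.aemeasurable (by simpa using hε.ne')
            ENNReal.coe_ne_top).trans ?_
          gcongr
          exact lintegral_encard_stray_div_encard_hub_le hE hi hη

end IndependentEdges

section RankOne

variable {Ω ι : Type*} {ζ : Sym2 ι → Ω → ℝ} {w : ι → ℝ≥0}

/-- The event that the uniform variable attached to the pair `{i, j}` is smaller than the product
of the weights of `i` and `j`. -/
def edgeEvent (ζ : Sym2 ι → Ω → ℝ) (w : ι → ℝ≥0) (e : Sym2 ι) : Set Ω :=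
  {ω | ζ e ω < (e.map w).mul}

variable [MeasurableSpace Ω] {P : Measure Ω}

lemma measurableSet_edgeEvent (hζ : ∀ e, Measurable (ζ e)) (e : Sym2 ι) :
    MeasurableSet (edgeEvent ζ w e) :=
  measurableSet_lt (hζ e) measurable_const

lemma iIndepSet_edgeEvent (hζ : ∀ e, Measurable (ζ e)) (hi : iIndepFun ζ P) :
    iIndepSet (edgeEvent ζ w) P := by
  rw [iIndepSet_iff_meas_biInter (measurableSet_edgeEvent hζ)]
  exact fun s => hi.meas_biInter fun e _ => ⟨Set.Iio _, measurableSet_Iio, rfl⟩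

lemma volume_Iio_inter_Icc_zero_one (a : ℝ≥0) :
    volume (Set.Iio (a : ℝ) ∩ Set.Icc 0 1) = min (a : ℝ≥0∞) 1 := by
  rcases le_or_gt a 1 with ha | ha
  · have hset : Set.Iio (a : ℝ) ∩ Set.Icc 0 1 = Set.Ico 0 (a : ℝ) := by
      ext x
      have ha' : (a : ℝ) ≤ 1 := by exact_mod_cast ha
      simp only [Set.mem_inter_iff, Set.mem_Iio, Set.mem_Icc, Set.mem_Ico]
      grind
    rw [hset, Real.volume_Ico, sub_zero, ENNReal.ofReal_coe_nnreal, min_eq_left (by simpa using ha)]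
  · have hset : Set.Iio (a : ℝ) ∩ Set.Icc 0 1 = Set.Icc 0 1 :=
      Set.inter_eq_right.2 fun x hx => hx.2.trans_lt (by exact_mod_cast ha)
    rw [hset, Real.volume_Icc, sub_zero, ENNReal.ofReal_one, min_eq_right (by simpa using ha.le)]

lemma measure_edgeEvent (hu : ∀ e, HasLaw (ζ e) (volume.restrict (Set.Icc (0 : ℝ) 1)) P)
    (i j : ι) : P (edgeEvent ζ w s(i, j)) = min (w i * w j : ℝ≥0∞) 1 := by
  calc P (edgeEvent ζ w s(i, j))
      = P.map (ζ s(i, j)) (Set.Iio ((w i * w j : ℝ≥0) : ℝ)) := by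
        rw [Measure.map_apply_of_aemeasurable (hu _).aemeasurable measurableSet_Iio]
        rfl
    _ = min (w i * w j : ℝ≥0∞) 1 := by
        rw [(hu _).map_eq, Measure.restrict_apply measurableSet_Iio, volume_Iio_inter_Icc_zero_one,
          ENNReal.coe_mul]

theorem measure_not_hasGiantHub_edgeEvent_le [Countable ι] (hζ : ∀ e, Measurable (ζ e))
    (hi : iIndepFun ζ P) (hu : ∀ e, HasLaw (ζ e) (volume.restrict (Set.Icc (0 : ℝ) 1)) P)
    (hw : ∀ i j, i ≠ j → w i * w j ≤ 1) (hsum : ∑' i, (w i : ℝ≥0∞) ≠ ⊤) {K : Finset ι}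
    {δ ε η : ℝ≥0} (hε : 0 < ε) (hδ : ∀ i ∈ K, δ ≤ w i)
    (hη : ∑' l : ↥(K : Set ι)ᶜ, (w l : ℝ≥0∞) ≤ η * ∑ j ∈ K, (w j : ℝ≥0∞)) :
    P {ω | ¬HasGiantHub (edgeGraph (edgeEvent ζ w) ω) K ε} ≤
      K.card.descFactorial 2 * (1 - (δ : ℝ≥0∞) ^ 4) ^ (K.card - 2) + 2 * η / ε := by
  have hprob {i j : ι} (hij : i ≠ j) : P (edgeEvent ζ w s(i, j)) = w i * w j := by
    rw [measure_edgeEvent hu, min_eq_left]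
    exact_mod_cast hw i j hij
  rw [show (δ : ℝ≥0∞) ^ 4 = (δ * δ) ^ 2 by ring]
  refine measure_not_hasGiantHub_le (measurableSet_edgeEvent hζ) (iIndepSet_edgeEvent hζ hi) hε
    (fun j _ => ?_) (fun i hiK j hjK hij => ?_) fun i hiK => ?_
  · refine ne_top_of_le_ne_top (ENNReal.mul_ne_top hsum (ENNReal.coe_ne_top (r := w j))) ?_
    rw [← ENNReal.tsum_mul_right]
    exact ENNReal.tsum_le_tsum fun i => (measure_edgeEvent hu i j).trans_le (min_le_left _ _)
  · rw [hprob hij]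
    gcongr
    exacts [hδ i hiK, hδ j hjK]
  · calc ∑' l : ↥(insert i (K : Set ι))ᶜ, P (edgeEvent ζ w s(i, l))
        = w i * ∑' l : ↥(insert i (K : Set ι))ᶜ, (w l : ℝ≥0∞) := by
          rw [← ENNReal.tsum_mul_left]
          exact tsum_congr fun l => hprob fun h => l.2 (Or.inl h.symm)
      _ ≤ w i * (η * ∑ j ∈ K, (w j : ℝ≥0∞)) := by
          gcongr
          refine (ENNReal.tsum_mono_subtype (fun l => (w l : ℝ≥0∞)) ?_).trans hη
          exact Set.compl_subset_compl.2 (Set.subset_insert _ _)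
      _ = η * ∑ j ∈ K, P (edgeEvent ζ w s(i, j)) := by
          rw [mul_left_comm, Finset.mul_sum]
          congr 1
          exact Finset.sum_congr rfl fun j hj => (hprob (ne_of_mem_of_not_mem hj hiK).symm).symm

end RankOne

section Lebesgue

lemma leb_apply (A : Set ℝ≥0) : leb A = volume (((↑) : ℝ≥0 → ℝ) '' A) :=
  (MeasurableEmbedding.subtype_coe measurableSet_Ici).comap_apply _ _

lemma leb_Iic (a : ℝ≥0) : leb (Set.Iic a) = a := by
  have himage : ((↑) : ℝ≥0 → ℝ) '' Set.Iic a = Set.Icc (0 : ℝ) a := by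
    rw [← Set.Icc_bot, bot_eq_zero, NNReal.image_coe_Icc, NNReal.coe_zero]
  rw [leb_apply, himage, Real.volume_Icc, sub_zero, ENNReal.ofReal_coe_nnreal]

instance : NullSingletonClass leb :=
  ⟨fun a => by rw [leb_apply, Set.image_singleton, Real.volume_singleton]⟩

instance : SigmaFinite leb2 :=
  inferInstanceAs (SigmaFinite (leb.prod leb))

lemma leb2_Iic_prod (ν : ℝ≥0) (s : Set ℝ≥0) : leb2 (Set.Iic ν ×ˢ s) = ν * leb s := by
  rw [leb2, Measure.prod_prod, leb_Iic]

end Lebesgue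

section Poisson

lemma succ_mul_poissonMeasure_singleton_succ (r : ℝ≥0) (k : ℕ) :
    ((k + 1 : ℕ) : ℝ≥0∞) * poissonMeasure r {k + 1} = r * poissonMeasure r {k} := by
  rw [poissonMeasure_singleton, poissonMeasure_singleton, ← ENNReal.ofReal_natCast,
    ← ENNReal.ofReal_coe_nnreal, ← ENNReal.ofReal_mul (by positivity),
    ← ENNReal.ofReal_mul (by positivity), Nat.factorial_succ]
  congr 1
  push_cast
  field_simp
  ring

lemma tsum_poissonMeasure_singleton (r : ℝ≥0) : ∑' k : ℕ, poissonMeasure r {k} = 1 := by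
  simpa using (lintegral_countable' (μ := poissonMeasure r) fun _ => 1).symm

lemma tsum_mul_poissonMeasure_singleton (r : ℝ≥0) :
    ∑' k : ℕ, (k : ℝ≥0∞) * poissonMeasure r {k} = r := by
  rw [tsum_eq_zero_add' ENNReal.summable]
  simp_rw [succ_mul_poissonMeasure_singleton_succ, ENNReal.tsum_mul_left,
    tsum_poissonMeasure_singleton]
  simp

lemma tsum_mul_mul_poissonMeasure_singleton (r : ℝ≥0) :
    ∑' k : ℕ, (k : ℝ≥0∞) * k * poissonMeasure r {k} = r * r + r := by
  rw [tsum_eq_zero_add' ENNReal.summable]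
  simp_rw [mul_assoc, succ_mul_poissonMeasure_singleton_succ, mul_left_comm _ (r : ℝ≥0∞),
    ENNReal.tsum_mul_left, Nat.cast_succ, add_mul, one_mul, ENNReal.summable.tsum_add
    ENNReal.summable, tsum_mul_poissonMeasure_singleton, tsum_poissonMeasure_singleton]
  simp [mul_add]

-- With `exp (-r) * r ^ k = 2 ^ k * exp (-r / 2) * (exp (-r / 2) * (r / 2) ^ k)`, the claim is that
-- `2 ^ k ≤ exp (3 * r / 8)`, which holds for `k ≤ r / 2` because `log 2 < 3 / 4`.
lemma poissonMeasure_singleton_le (r : ℝ≥0) {k : ℕ} (hk : (k : ℝ) ≤ r / 2) :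
    poissonMeasure r {k} ≤ ENNReal.ofReal (Real.exp (-(r / 8))) * poissonMeasure (r / 2) {k} := by
  have hpow : (2 : ℝ) ^ k ≤ Real.exp (3 * r / 8) := by
    rw [← Real.exp_log (x := (2 : ℝ) ^ k) (by positivity), Real.log_pow, Real.exp_le_exp]
    nlinarith [Real.log_two_lt_d9, r.2,
      mul_le_mul_of_nonneg_right hk (Real.log_nonneg one_le_two)]
  have hr : (r : ℝ) ^ k = 2 ^ k * (r / 2) ^ k := by
    rw [← mul_pow, mul_div_cancel₀ _ two_ne_zero]
  rw [poissonMeasure_singleton, poissonMeasure_singleton, ← ENNReal.ofReal_mul (Real.exp_nonneg _)]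
  refine ENNReal.ofReal_le_ofReal ?_
  calc Real.exp (-r) * (r : ℝ) ^ k / k.factorial
      = Real.exp (-r) * 2 ^ k * ((r / 2) ^ k / k.factorial) := by rw [hr]; ring
    _ ≤ Real.exp (-r) * Real.exp (3 * r / 8) * ((r / 2) ^ k / k.factorial) := by gcongr
    _ = Real.exp (-(r / 8)) * (Real.exp (-(r / 2)) * (r / 2) ^ k / k.factorial) := by
        rw [mul_div_assoc (Real.exp _), ← mul_assoc, ← Real.exp_add, ← Real.exp_add]
        ring_nf
    _ = Real.exp (-(r / 8)) *
          (Real.exp (-(r / 2 : ℝ≥0)) * ((r / 2 : ℝ≥0) : ℝ) ^ k / k.factorial) := by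
        push_cast
        rfl

variable {Ω E : Type*} [MeasurableSpace Ω] [MeasurableSpace E] {X : ℕ → Ω → E} {m : Measure E}
  {P : Measure Ω} {A : Set E}

/-- The intensity measure `A ↦ ∑ i, P (X i ∈ A)` of a sequence of random points. -/
noncomputable def intensity (X : ℕ → Ω → E) (P : Measure Ω) : Measure E :=
  Measure.sum fun i => P.map (X i)

/-- The second factorial moment measure `S ↦ ∑ i ≠ j, P ((X i, X j) ∈ S)` of a sequence of random
points. -/
noncomputable def pairIntensity (X : ℕ → Ω → E) (P : Measure Ω) : Measure (E × E) :=
  Measure.sum fun p : (Set.univ.offDiag : Set (ℕ × ℕ)) => P.map fun ω => (X p.1.1 ω, X p.1.2 ω)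

lemma measurable_count (hX : ∀ i, Measurable (X i)) (hA : MeasurableSet A) :
    Measurable fun ω => (count (fun i => X i ω) A : ℝ≥0∞) :=
  measurable_encard_toENNReal <| measurable_set_iff.2 fun i =>
    measurableSet_setOfPred.1 (hX i hA)

lemma lintegral_count_eq_intensity (hX : ∀ i, Measurable (X i)) (hA : MeasurableSet A) :
    ∫⁻ ω, (count (fun i => X i ω) A : ℝ≥0∞) ∂P = intensity X P A := by
  simp_rw [count, encard_eq_tsum]
  rw [intensity, Measure.sum_apply _ hA, lintegral_tsum fun i => ?_]
  · refine tsum_congr fun i => ?_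
    rw [Measure.map_apply (hX i) hA, ← lintegral_indicator_one (hX i hA)]
    rfl
  · exact (measurable_one.indicator (hX i hA)).aemeasurable

lemma lintegral_count_mul_count_eq (hX : ∀ i, Measurable (X i)) {B : Set E}
    (hA : MeasurableSet A) (hB : MeasurableSet B) :
    ∫⁻ ω, (count (fun i => X i ω) A * count (fun i => X i ω) B : ℝ≥0∞) ∂P =
      pairIntensity X P (A ×ˢ B) + intensity X P (A ∩ B) := by
  have hpair (p : ℕ × ℕ) : MeasurableSet {ω | X p.1 ω ∈ A ∧ X p.2 ω ∈ B} :=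
    (hX p.1 hA).inter (hX p.2 hB)
  calc ∫⁻ ω, (count (fun i => X i ω) A * count (fun i => X i ω) B : ℝ≥0∞) ∂P
      = ∫⁻ ω, ∑' p : ℕ × ℕ, {ω | X p.1 ω ∈ A ∧ X p.2 ω ∈ B}.indicator 1 ω ∂P := by
        refine lintegral_congr fun ω => ?_
        simp_rw [count, encard_eq_tsum, ← ENNReal.tsum_mul_right, ← ENNReal.tsum_mul_left]
        rw [← ENNReal.tsum_prod]
        refine tsum_congr fun p => ?_
        by_cases hiA : X p.1 ω ∈ A <;> by_cases hjB : X p.2 ω ∈ B <;> simp [hiA, hjB]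
    _ = ∑' p : ℕ × ℕ, P {ω | X p.1 ω ∈ A ∧ X p.2 ω ∈ B} := by
        rw [lintegral_tsum fun p => (measurable_one.indicator (hpair p)).aemeasurable]
        exact tsum_congr fun p => lintegral_indicator_one (hpair p)
    _ = ∑' p : (Set.univ.offDiag : Set (ℕ × ℕ)), P {ω | X p.1.1 ω ∈ A ∧ X p.1.2 ω ∈ B} +
          ∑' p : ((Set.univ.offDiag)ᶜ : Set (ℕ × ℕ)), P {ω | X p.1.1 ω ∈ A ∧ X p.1.2 ω ∈ B} :=
        (ENNReal.summable.tsum_add_tsum_compl ENNReal.summable).symm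
    _ = pairIntensity X P (A ×ˢ B) + intensity X P (A ∩ B) := by
        have hdiag : ((Set.univ.offDiag)ᶜ : Set (ℕ × ℕ)) = Set.range fun i => (i, i) := by
          ext ⟨i, j⟩
          simp [eq_comm]
        rw [pairIntensity, intensity, Measure.sum_apply _ (hA.prod hB),
          Measure.sum_apply _ (hA.inter hB), hdiag,
          tsum_range (fun p : ℕ × ℕ => P {ω | X p.1 ω ∈ A ∧ X p.2 ω ∈ B})
            fun i j h => congrArg Prod.fst h]
        congr 1
        · exact tsum_congr fun p =>
            (Measure.map_apply ((hX _).prodMk (hX _)) (hA.prod hB)).symm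
        · exact tsum_congr fun i => (Measure.map_apply (hX i) (hA.inter hB)).symm

lemma generateFrom_measure_lt_top [SigmaFinite m] :
    MeasurableSpace.generateFrom {A | MeasurableSet A ∧ m A < ⊤} = ‹MeasurableSpace E› := by
  refine le_antisymm (MeasurableSpace.generateFrom_le fun A hA => hA.1) fun A hA => ?_
  rw [← Set.inter_univ A, ← iUnion_spanningSets m, Set.inter_iUnion]
  exact MeasurableSet.iUnion fun n => MeasurableSpace.measurableSet_generateFrom
    ⟨hA.inter (measurableSet_spanningSets m n),
      (measure_mono Set.inter_subset_right).trans_lt (measure_spanningSets_lt_top m n)⟩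

lemma isPiSystem_measure_lt_top : IsPiSystem {A | MeasurableSet A ∧ m A < ⊤} :=
  fun _ hA _ hB _ => ⟨hA.1.inter hB.1, (measure_mono Set.inter_subset_left).trans_lt hA.2⟩

namespace IsPoissonProcess

lemma lintegral_count_comp (hX : IsPoissonProcess X m P) (hA : MeasurableSet A) (hAm : m A < ⊤)
    (φ : ℕ∞ → ℝ≥0∞) :
    ∫⁻ ω, φ (count (fun i => X i ω) A) ∂P =
      ∑' k : ℕ, φ k * poissonMeasure (m A).toNNReal {k} := by
  have hlaw := hX.hasLaw A hA hAm
  have hφ : Measurable φ := measurable_of_countable φ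
  rw [← lintegral_map' hφ.aemeasurable hlaw.aemeasurable, hlaw.map_eq,
    lintegral_map hφ (by fun_prop), lintegral_countable']

lemma lintegral_count (hX : IsPoissonProcess X m P) (hA : MeasurableSet A) (hAm : m A < ⊤) :
    ∫⁻ ω, (count (fun i => X i ω) A : ℝ≥0∞) ∂P = m A := by
  rw [hX.lintegral_count_comp hA hAm (fun k => (k : ℝ≥0∞))]
  simp only [ENat.toENNReal_coe]
  rw [tsum_mul_poissonMeasure_singleton, ENNReal.coe_toNNReal hAm.ne]

lemma lintegral_count_mul_self (hX : IsPoissonProcess X m P) (hA : MeasurableSet A)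
    (hAm : m A < ⊤) :
    ∫⁻ ω, (count (fun i => X i ω) A * count (fun i => X i ω) A : ℝ≥0∞) ∂P =
      m A * m A + m A := by
  rw [hX.lintegral_count_comp hA hAm (fun k => (k : ℝ≥0∞) * k)]
  simp only [ENat.toENNReal_coe]
  rw [tsum_mul_mul_poissonMeasure_singleton, ENNReal.coe_toNNReal hAm.ne]

lemma lintegral_count_mul_count (hX : IsPoissonProcess X m P) {B : Set E} (hA : MeasurableSet A)
    (hAm : m A < ⊤) (hB : MeasurableSet B) (hBm : m B < ⊤) (hAB : Disjoint A B) :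
    ∫⁻ ω, (count (fun i => X i ω) A * count (fun i => X i ω) B : ℝ≥0∞) ∂P = m A * m B := by
  have hindep : IndepFun (fun ω => count (fun i => X i ω) A) (fun ω => count (fun i => X i ω) B)
      P :=
    (hX.indep 2 ![A, B] (by simp [Fin.forall_fin_two, hA, hB])
      (by simp [Fin.forall_fin_two, hAm, hBm])
      (by simp [Fin.forall_fin_two, hAB, hAB.symm])).indepFun (i := 0) (j := 1) zero_ne_one
  rw [← hX.lintegral_count hA hAm, ← hX.lintegral_count hB hBm]
  exact lintegral_mul_eq_lintegral_mul_lintegral_of_indepFun (measurable_count hX.measurable hA)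
    (measurable_count hX.measurable hB) (hindep.comp (φ := ENat.toENNReal) (ψ := ENat.toENNReal)
      .of_discrete .of_discrete)

theorem intensity_eq [SigmaFinite m] (hX : IsPoissonProcess X m P) : intensity X P = m :=
  .symm <| Measure.ext_of_generateFrom_of_iUnion _ (spanningSets m)
    generateFrom_measure_lt_top.symm isPiSystem_measure_lt_top (iUnion_spanningSets m)
    (fun n => ⟨measurableSet_spanningSets m n, measure_spanningSets_lt_top m n⟩)
    (fun n => (measure_spanningSets_lt_top m n).ne) fun _ hA => by
      rw [← lintegral_count_eq_intensity hX.measurable hA.1, hX.lintegral_count hA.1 hA.2]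

theorem lintegral_tsum [SigmaFinite m] (hX : IsPoissonProcess X m P) {φ : E → ℝ≥0∞}
    (hφ : Measurable φ) : ∫⁻ ω, ∑' i, φ (X i ω) ∂P = ∫⁻ x, φ x ∂m := by
  simp_rw [← hX.intensity_eq, intensity, lintegral_sum_measure, lintegral_map hφ (hX.measurable _)]
  exact MeasureTheory.lintegral_tsum fun i => (hφ.comp (hX.measurable i)).aemeasurable

lemma pairIntensity_prod_self [SigmaFinite m] (hX : IsPoissonProcess X m P)
    (hA : MeasurableSet A) (hAm : m A < ⊤) : pairIntensity X P (A ×ˢ A) = m A * m A := by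
  have h := lintegral_count_mul_count_eq (P := P) hX.measurable hA hA
  rw [hX.lintegral_count_mul_self hA hAm, Set.inter_self, hX.intensity_eq] at h
  exact ((ENNReal.add_left_inj hAm.ne).1 h).symm

lemma pairIntensity_prod_of_disjoint (hX : IsPoissonProcess X m P) {B : Set E}
    (hA : MeasurableSet A) (hAm : m A < ⊤) (hB : MeasurableSet B) (hBm : m B < ⊤)
    (hAB : Disjoint A B) : pairIntensity X P (A ×ˢ B) = m A * m B := by
  rw [← hX.lintegral_count_mul_count hA hAm hB hBm hAB,
    lintegral_count_mul_count_eq hX.measurable hA hB, hAB.inter_eq, measure_empty, add_zero]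

lemma pairIntensity_prod [SigmaFinite m] (hX : IsPoissonProcess X m P) {B : Set E}
    (hA : MeasurableSet A) (hAm : m A < ⊤) (hB : MeasurableSet B) (hBm : m B < ⊤) :
    pairIntensity X P (A ×ˢ B) = m A * m B := by
  have hABm : m (A ∩ B) < ⊤ := (measure_mono Set.inter_subset_left).trans_lt hAm
  calc pairIntensity X P (A ×ˢ B)
      = pairIntensity X P ((A ∩ B) ×ˢ B) + pairIntensity X P ((A \ B) ×ˢ B) := by
        rw [← measure_union (Set.Disjoint.set_prod_left (by grind) _ _) ((hA.diff hB).prod hB),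
          ← Set.union_prod, Set.inter_union_sdiff]
    _ = pairIntensity X P ((A ∩ B) ×ˢ (A ∩ B)) + pairIntensity X P ((A ∩ B) ×ˢ (B \ A)) +
          pairIntensity X P ((A \ B) ×ˢ B) := by
        rw [← measure_union (Set.Disjoint.set_prod_right (by grind) _ _)
          ((hA.inter hB).prod (hB.diff hA)), ← Set.prod_union, Set.inter_comm A B,
          Set.inter_union_sdiff]
    _ = m (A ∩ B) * m (A ∩ B) + m (A ∩ B) * m (B \ A) + m (A \ B) * m B := by
        rw [hX.pairIntensity_prod_self (hA.inter hB) hABm,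
          hX.pairIntensity_prod_of_disjoint (hA.inter hB) hABm (hB.diff hA)
            ((measure_mono Set.sdiff_subset).trans_lt hBm) (by grind),
          hX.pairIntensity_prod_of_disjoint (hA.diff hB)
            ((measure_mono Set.sdiff_subset).trans_lt hAm) hB hBm Set.disjoint_sdiff_left]
    _ = m A * m B := by
        rw [← mul_add, Set.inter_comm, measure_inter_add_sdiff B hA, Set.inter_comm, ← add_mul,
          measure_inter_add_sdiff A hB]

theorem pairIntensity_eq [SigmaFinite m] (hX : IsPoissonProcess X m P) :
    pairIntensity X P = m.prod m :=
  let S : m.FiniteSpanningSetsIn {A | MeasurableSet A ∧ m A < ⊤} :=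
    ⟨spanningSets m, fun n => ⟨measurableSet_spanningSets m n, measure_spanningSets_lt_top m n⟩,
      measure_spanningSets_lt_top m, iUnion_spanningSets m⟩
  (Measure.prod_eq_generateFrom generateFrom_measure_lt_top generateFrom_measure_lt_top
    isPiSystem_measure_lt_top isPiSystem_measure_lt_top S S
    fun _ hA _ hB => hX.pairIntensity_prod hA.1 hA.2 hB.1 hB.2).symm

theorem ae_injective_comp [SigmaFinite m] (hX : IsPoissonProcess X m P) {Y : Type*}
    [MeasurableSpace Y] [MeasurableEq Y] {g : E → Y} (hg : Measurable g)
    (hfibre : ∀ y, m (g ⁻¹' {y}) = 0) : ∀ᵐ ω ∂P, Function.Injective fun i => g (X i ω) := by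
  have hS : MeasurableSet {p : E × E | g p.1 = g p.2} :=
    measurableSet_eq_fun (hg.comp measurable_fst) (hg.comp measurable_snd)
  have hnull : pairIntensity X P {p : E × E | g p.1 = g p.2} = 0 := by
    rw [hX.pairIntensity_eq, Measure.measure_prod_null hS]
    refine ae_of_all _ fun x => measure_mono_null (fun y hy => ?_) (hfibre (g x))
    exact Eq.symm hy
  have hpair (p : (Set.univ.offDiag : Set (ℕ × ℕ))) :
      P {ω | g (X p.1.1 ω) = g (X p.1.2 ω)} = 0 := by
    rw [pairIntensity, Measure.sum_apply _ hS, ENNReal.tsum_eq_zero] at hnull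
    rw [← hnull p, Measure.map_apply ((hX.measurable _).prodMk (hX.measurable _)) hS]
    rfl
  filter_upwards [ae_all_iff.2 fun p => measure_eq_zero_iff_ae_notMem.1 (hpair p)] with ω hω i j hij
  by_contra hne
  exact hω ⟨(i, j), ⟨trivial, trivial, hne⟩⟩ hij

lemma measure_count_mem (hX : IsPoissonProcess X m P) (hA : MeasurableSet A) (hAm : m A < ⊤)
    (s : Set ℕ∞) :
    P {ω | count (fun i => X i ω) A ∈ s} =
      ∑' k : ℕ, s.indicator 1 (k : ℕ∞) * poissonMeasure (m A).toNNReal {k} := by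
  rw [← hX.lintegral_count_comp hA hAm (s.indicator 1)]
  exact (lintegral_indicator_one₀ <| (hX.hasLaw A hA hAm).aemeasurable.nullMeasurableSet_preimage
    s.to_countable.measurableSet).symm

theorem measure_count_lt_half_le (hX : IsPoissonProcess X m P) (hA : MeasurableSet A)
    (hAm : m A < ⊤) :
    P {ω | (count (fun i => X i ω) A : ℝ≥0∞) < m A / 2} ≤
      ENNReal.ofReal (Real.exp (-((m A).toReal / 8))) := by
  have hlaw := hX.measure_count_mem hA hAm {k | (k : ℝ≥0∞) < m A / 2}
  lift m A to ℝ≥0 using hAm.ne with r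
  rw [ENNReal.toNNReal_coe] at hlaw
  calc P {ω | (count (fun i => X i ω) A : ℝ≥0∞) < r / 2}
      = ∑' k : ℕ, {k : ℕ∞ | (k : ℝ≥0∞) < r / 2}.indicator 1 (k : ℕ∞) * poissonMeasure r {k} :=
        hlaw
    _ ≤ ∑' k : ℕ, ENNReal.ofReal (Real.exp (-(r / 8))) * poissonMeasure (r / 2) {k} := by
        refine ENNReal.tsum_le_tsum fun k => ?_
        by_cases hk : (k : ℝ≥0∞) < r / 2
        · rw [Set.indicator_of_mem (by simpa using hk), Pi.one_apply, one_mul]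
          exact poissonMeasure_singleton_le r
            (by simpa using ENNReal.toReal_mono (by finiteness) hk.le)
        · rw [Set.indicator_of_notMem (by simpa using hk), zero_mul]
          exact zero_le
    _ = ENNReal.ofReal (Real.exp (-(r / 8))) := by
        rw [ENNReal.tsum_mul_left, tsum_poissonMeasure_singleton, mul_one]

end IsPoissonProcess

end Poisson

section Separable

variable {f : ℝ≥0 → ℝ}

lemma separable_of_ne {x y : ℝ≥0} (hxy : x ≠ y) : separable f x y = f x * f y :=
  if_neg hxy

lemma nnnorm_mul_nnnorm_eq_separable (hW : IsGraphex (separable f)) {x y : ℝ≥0} (hxy : x ≠ y) :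
    ((‖f x‖₊ * ‖f y‖₊ : ℝ≥0) : ℝ) = separable f x y := by
  rw [← nnnorm_mul, coe_nnnorm, ← separable_of_ne hxy, Real.norm_of_nonneg (hW.mem_Icc x y).1]

lemma nnnorm_mul_nnnorm_le_one (hW : IsGraphex (separable f)) {x y : ℝ≥0} (hxy : x ≠ y) :
    ‖f x‖₊ * ‖f y‖₊ ≤ 1 := by
  rw [← NNReal.coe_le_coe, nnnorm_mul_nnnorm_eq_separable hW hxy]
  exact (hW.mem_Icc x y).2

lemma measurable_of_isGraphex_separable (hW : IsGraphex (separable f)) : Measurable f := by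
  classical
  by_cases hf : ∃ y, f y ≠ 0
  · obtain ⟨y, hy⟩ := hf
    have hsection : Measurable fun x => separable f x y / f y :=
      (hW.measurable.comp (measurable_id.prodMk measurable_const)).div_const _
    have heq : f = fun x => if x = y then f y else separable f x y / f y := by
      ext x
      split_ifs with hx
      · rw [hx]
      · rw [separable_of_ne hx, mul_div_cancel_right₀ _ hy]
    rw [heq]
    exact Measurable.ite (measurableSet_singleton y) measurable_const hsection
  · push Not at hf
    exact (funext hf : f = fun _ => 0) ▸ measurable_const

lemma marginal_separable (hW : IsGraphex (separable f)) (x : ℝ≥0) :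
    marginal (separable f) x = ‖f x‖₊ * ∫⁻ y, ‖f y‖₊ ∂leb := by
  have hfm := (measurable_of_isGraphex_separable hW).nnnorm.coe_nnreal_ennreal
  rw [marginal, ← lintegral_const_mul _ hfm]
  refine lintegral_congr_ae ((Measure.ae_ne leb x).mono fun y hy => ?_)
  simp only [← nnnorm_mul_nnnorm_eq_separable hW hy.symm, ENNReal.ofReal_coe_nnreal,
    ENNReal.coe_mul]

lemma lintegral_nnnorm_ne_top (hW : IsGraphex (separable f)) (hf : ¬ ∀ᵐ x ∂leb, f x = 0) :
    ∫⁻ y, ‖f y‖₊ ∂leb ≠ ⊤ := by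
  intro htop
  refine hf (measure_mono_null (fun x (hx : f x ≠ 0) => ?_) hW.marginal_top)
  rw [Set.mem_ofPred_eq, marginal_separable hW, htop]
  exact ENNReal.mul_top (by simpa using hx)

end Separable

section Levels

variable {E : Type*} [MeasurableSpace E] {m : Measure E} {g : E → ℝ≥0}

lemma exists_measure_le_ne_zero (hg : ¬ g =ᵐ[m] 0) :
    ∃ δ : ℝ≥0, 0 < δ ∧ m {x | δ ≤ g x} ≠ 0 := by
  by_contra! h
  refine hg (measure_mono_null (t := ⋃ n : ℕ, {x | 1 / ((n : ℝ≥0) + 1) ≤ g x})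
    (fun x hx => ?_) (measure_iUnion_null fun n => h _ (by positivity)))
  obtain ⟨n, hn⟩ := exists_nat_one_div_lt (pos_iff_ne_zero.2 hx)
  exact Set.mem_iUnion.2 ⟨n, hn.le⟩

lemma measure_le_ne_top (hg : Measurable g) (hI : ∫⁻ x, g x ∂m ≠ ⊤) {δ : ℝ≥0} (hδ : 0 < δ) :
    m {x | δ ≤ g x} ≠ ⊤ := by
  have hδ' : (δ : ℝ≥0∞) ≠ 0 := ENNReal.coe_ne_zero.2 hδ.ne'
  refine ne_top_of_le_ne_top (ENNReal.div_ne_top hI hδ') ?_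
  simpa only [ENNReal.coe_le_coe] using
    meas_ge_le_lintegral_div hg.coe_nnreal_ennreal.aemeasurable hδ' ENNReal.coe_ne_top

lemma tendsto_setLIntegral_lt_zero (hg : Measurable g) (hI : ∫⁻ x, g x ∂m ≠ ⊤) :
    Tendsto (fun δ : ℝ≥0 => ∫⁻ x in {x | g x < δ}, g x ∂m) (𝓝[>] 0) (𝓝 0) := by
  have hmeas (δ : ℝ≥0) : MeasurableSet {x | g x < δ} := measurableSet_lt hg measurable_const
  simp_rw [← lintegral_indicator (hmeas _)]
  rw [← lintegral_zero (μ := m)]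
  refine tendsto_lintegral_filter_of_dominated_convergence (fun x => (g x : ℝ≥0∞))
    (.of_forall fun δ => hg.coe_nnreal_ennreal.indicator (hmeas δ))
    (.of_forall fun δ => .of_forall fun x => Set.indicator_le_self _ _ _) hI
    (.of_forall fun x => tendsto_const_nhds.congr' ?_)
  rcases eq_or_ne (g x) 0 with hx | hx
  · exact .of_forall fun δ => by simp [Set.indicator_apply, hx]
  · filter_upwards [nhdsWithin_le_nhds (eventually_lt_nhds (pos_of_ne_zero hx))] with δ hδ
    exact (Set.indicator_of_notMem (s := {x | g x < δ}) (hδ.not_gt) _).symm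

end Levels

lemma tendsto_measure_one_of_compl {Ω ι : Type*} [MeasurableSpace Ω] {P : Measure Ω}
    [IsProbabilityMeasure P] {l : Filter ι} {s : ι → Set Ω}
    (h : Tendsto (fun i => P (s i)ᶜ) l (𝓝 0)) : Tendsto (fun i => P (s i)) l (𝓝 1) := by
  have hsub : Tendsto (fun i => 1 - P (s i)ᶜ) l (𝓝 1) := by
    simpa using ENNReal.Tendsto.sub tendsto_const_nhds h (Or.inl ENNReal.one_ne_top)
  refine tendsto_of_tendsto_of_tendsto_of_le_of_le hsub tendsto_const_nhds (fun i => ?_)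
    fun i => prob_le_one
  exact tsub_le_iff_right.2 (measure_univ (μ := P) ▸ measure_univ_le_add_compl _)

lemma tendsto_descFactorial_mul_pow {q : ℝ≥0∞} (hq : q < 1) :
    Tendsto (fun n : ℕ => (n.descFactorial 2 : ℝ≥0∞) * q ^ (n - 2)) atTop (𝓝 0) := by
  lift q to ℝ≥0 using hq.ne_top
  rw [← tendsto_add_atTop_iff_nat 2]
  have hsum := summable_descFactorial_mul_geometric_of_norm_lt_one 2 (r := (q : ℝ))
    (by simpa using hq)
  have h := ENNReal.tendsto_ofReal hsum.tendsto_atTop_zero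
  rw [ENNReal.ofReal_zero] at h
  refine h.congr fun n => ?_
  rw [ENNReal.ofReal_mul (by positivity), ENNReal.ofReal_natCast, ← NNReal.coe_pow,
    ENNReal.ofReal_coe_nnreal, ENNReal.coe_pow, Nat.add_sub_cancel]

section Weights

/-- The weight of the latent point `p = (θ, ϑ)` in the `ν`-truncation: `g ϑ`, except that points
with label `θ > ν`, which are not in the truncation, get weight zero. -/
noncomputable def weight (g : ℝ≥0 → ℝ≥0) (ν : ℝ≥0) (p : ℝ≥0 × ℝ≥0) : ℝ≥0 :=
  if p.1 ≤ ν then g p.2 else 0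

/-- The indices of weight at least `δ`. -/
def core {ι : Type*} (w : ι → ℝ≥0) (δ : ℝ≥0) : Set ι :=
  {i | δ ≤ w i}

/-- The core of the weights `w` at level `δ` has at least `n` elements and carries all of the total
weight but a fraction of at most `η`. The sums are taken in `[0, ∞]`. -/
structure HasHeavyCore {ι : Type*} (w : ι → ℝ≥0) (δ η : ℝ≥0) (n : ℕ) : Prop where
  le_encard : n ≤ (core w δ).encard
  tsum_compl_le : ∑' i : ↥(core w δ)ᶜ, (w i : ℝ≥0∞) ≤ η * ∑' i : core w δ, (w i : ℝ≥0∞)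

lemma finite_core {ι : Type*} {w : ι → ℝ≥0} (hw : ∑' i, (w i : ℝ≥0∞) ≠ ⊤) {δ : ℝ≥0} (hδ : 0 < δ) :
    (core w δ).Finite := by
  simpa only [core, ENNReal.coe_le_coe] using
    ENNReal.finite_const_le_of_tsum_ne_top hw (ENNReal.coe_ne_zero.2 hδ.ne')

variable {g : ℝ≥0 → ℝ≥0} {ν δ : ℝ≥0}

lemma mem_core_weight (hδ : 0 < δ) {x : ℕ → ℝ≥0 × ℝ≥0} {i : ℕ} :
    i ∈ core (fun i => weight g ν (x i)) δ ↔ x i ∈ Set.Iic ν ×ˢ {y | δ ≤ g y} := by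
  by_cases h : (x i).1 ≤ ν <;> simp [core, weight, h, hδ.ne']

lemma tsum_compl_core_weight (hδ : 0 < δ) (x : ℕ → ℝ≥0 × ℝ≥0) :
    ∑' i : ↥(core (fun i => weight g ν (x i)) δ)ᶜ, (weight g ν (x i) : ℝ≥0∞) =
      ∑' i, (Set.univ ×ˢ {y | g y < δ}).indicator (fun p => (weight g ν p : ℝ≥0∞)) (x i) := by
  classical
  rw [tsum_subtype _ fun i => (weight g ν (x i) : ℝ≥0∞)]
  refine tsum_congr fun i => ?_
  simp only [Set.indicator_apply, Set.mem_compl_iff, mem_core_weight hδ]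
  by_cases h : (x i).1 ≤ ν <;> simp [weight, h]

lemma mul_count_le_tsum_core_weight (hδ : 0 < δ) {δ₀ : ℝ≥0} (hδ₀ : δ ≤ δ₀)
    (x : ℕ → ℝ≥0 × ℝ≥0) :
    δ₀ * (count x (Set.Iic ν ×ˢ {y | δ₀ ≤ g y}) : ℝ≥0∞) ≤
      ∑' i : core (fun i => weight g ν (x i)) δ, (weight g ν (x i) : ℝ≥0∞) := by
  rw [count, mul_comm, ← ENNReal.tsum_set_const]
  calc ∑' _ : {i | x i ∈ Set.Iic ν ×ˢ {y | δ₀ ≤ g y}}, (δ₀ : ℝ≥0∞)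
      ≤ ∑' i : {i | x i ∈ Set.Iic ν ×ˢ {y | δ₀ ≤ g y}}, (weight g ν (x i) : ℝ≥0∞) :=
        ENNReal.tsum_le_tsum fun i =>
          ENNReal.coe_le_coe.2 <| (mem_core_weight (hδ.trans_le hδ₀)).2 i.2
    _ ≤ ∑' i : core (fun i => weight g ν (x i)) δ, (weight g ν (x i) : ℝ≥0∞) :=
        ENNReal.tsum_mono_subtype (fun i => (weight g ν (x i) : ℝ≥0∞)) fun i hi =>
          (mem_core_weight hδ).2 ⟨hi.1, hδ₀.trans hi.2⟩

lemma hasHeavyCore_weight_of_le_count (hδ : 0 < δ) {δ₀ : ℝ≥0} (hδ₀ : δ ≤ δ₀)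
    {x : ℕ → ℝ≥0 × ℝ≥0} {η : ℝ≥0} {n : ℕ} {c : ℝ≥0∞} (hn : n ≤ c)
    (hc : c ≤ count x (Set.Iic ν ×ˢ {y | δ₀ ≤ g y}))
    (htail : ∑' i : ↥(core (fun i => weight g ν (x i)) δ)ᶜ, (weight g ν (x i) : ℝ≥0∞) ≤
      η * (δ₀ * c)) :
    HasHeavyCore (fun i => weight g ν (x i)) δ η n where
  le_encard := by
    have hcount : (n : ℕ∞) ≤ count x (Set.Iic ν ×ˢ {y | δ₀ ≤ g y}) :=
      ENat.toENNReal_le.1 <| (ENat.toENNReal_coe n).trans_le (hn.trans hc)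
    exact hcount.trans <| Set.encard_le_encard fun i hi =>
      (mem_core_weight hδ).2 ⟨hi.1, hδ₀.trans hi.2⟩
  tsum_compl_le := by
    refine htail.trans ?_
    gcongr
    exact (mul_le_mul_right hc _).trans (mul_count_le_tsum_core_weight hδ hδ₀ x)

lemma measurable_weight (hg : Measurable g) (ν : ℝ≥0) : Measurable (weight g ν) :=
  Measurable.ite (measurableSet_le measurable_fst measurable_const) (hg.comp measurable_snd)
    measurable_const

lemma setLIntegral_weight (hg : Measurable g) (ν : ℝ≥0) (s : Set ℝ≥0) :
    ∫⁻ p in Set.univ ×ˢ s, weight g ν p ∂leb2 = ν * ∫⁻ y in s, g y ∂leb := by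
  have hinner (x : ℝ≥0) : ∫⁻ y in s, weight g ν (x, y) ∂leb =
      (Set.Iic ν).indicator (fun _ => ∫⁻ y in s, g y ∂leb) x := by
    by_cases hx : x ≤ ν <;> simp [weight, hx]
  rw [leb2, ← Measure.prod_restrict, Measure.restrict_univ,
    lintegral_prod _ (measurable_weight hg ν).coe_nnreal_ennreal.aemeasurable]
  simp_rw [hinner]
  rw [lintegral_indicator_const measurableSet_Iic, leb_Iic, mul_comm]

variable {Ω : Type*} [MeasurableSpace Ω] {P : Measure Ω} {X : ℕ → Ω → ℝ≥0 × ℝ≥0}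

lemma ae_tsum_weight_ne_top (hX : IsPoissonProcess X leb2 P) (hg : Measurable g)
    (hI : ∫⁻ y, g y ∂leb ≠ ⊤) (ν : ℝ≥0) : ∀ᵐ ω ∂P, ∑' i, (weight g ν (X i ω) : ℝ≥0∞) ≠ ⊤ := by
  have hw := (measurable_weight hg ν).coe_nnreal_ennreal
  have htotal := setLIntegral_weight hg ν Set.univ
  rw [Set.univ_prod_univ, setLIntegral_univ, setLIntegral_univ] at htotal
  refine (ae_lt_top (Measurable.tsum fun i => hw.comp (hX.measurable i)) ?_).mono
    fun ω hω => hω.ne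
  exact (hX.lintegral_tsum hw).trans htotal ▸ ENNReal.mul_ne_top ENNReal.coe_ne_top hI

lemma measurable_tsum_compl_core_weight (hX : IsPoissonProcess X leb2 P) (hg : Measurable g)
    (hδ : 0 < δ) (ν : ℝ≥0) :
    Measurable fun ω =>
      ∑' i : ↥(core (fun i => weight g ν (X i ω)) δ)ᶜ, (weight g ν (X i ω) : ℝ≥0∞) := by
  simp_rw [tsum_compl_core_weight hδ]
  exact Measurable.tsum fun i => ((measurable_weight hg ν).coe_nnreal_ennreal.indicator
    (MeasurableSet.univ.prod (measurableSet_lt hg measurable_const))).comp (hX.measurable i)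

lemma lintegral_tsum_compl_core_weight (hX : IsPoissonProcess X leb2 P) (hg : Measurable g)
    (hδ : 0 < δ) (ν : ℝ≥0) :
    ∫⁻ ω, ∑' i : ↥(core (fun i => weight g ν (X i ω)) δ)ᶜ, (weight g ν (X i ω) : ℝ≥0∞) ∂P =
      ν * ∫⁻ y in {y | g y < δ}, g y ∂leb := by
  have hs : MeasurableSet (Set.univ ×ˢ {y | g y < δ} : Set (ℝ≥0 × ℝ≥0)) :=
    MeasurableSet.univ.prod (measurableSet_lt hg measurable_const)
  simp_rw [tsum_compl_core_weight hδ]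
  rw [hX.lintegral_tsum ((measurable_weight hg ν).coe_nnreal_ennreal.indicator hs),
    lintegral_indicator hs, setLIntegral_weight hg]

lemma measure_not_hasHeavyCore_le (hX : IsPoissonProcess X leb2 P) (hg : Measurable g)
    (hI : ∫⁻ y, g y ∂leb ≠ ⊤) (hδ : 0 < δ) {δ₀ : ℝ≥0} (hδ₀ : δ ≤ δ₀)
    (hlevel : leb {y | δ₀ ≤ g y} ≠ 0) {η : ℝ≥0} (hη : 0 < η) (hν : 0 < ν) {n : ℕ}
    (hn : n ≤ ν * leb {y | δ₀ ≤ g y} / 2) :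
    P {ω | ¬HasHeavyCore (fun i => weight g ν (X i ω)) δ η n} ≤
      ENNReal.ofReal (Real.exp (-((ν * leb {y | δ₀ ≤ g y}).toReal / 8))) +
        (∫⁻ y in {y | g y < δ}, g y ∂leb) / (η * δ₀ * leb {y | δ₀ ≤ g y} / 2) := by
  have hlevel' := measure_le_ne_top hg hI (hδ.trans_le hδ₀)
  set a := leb {y | δ₀ ≤ g y}
  set A := Set.Iic ν ×ˢ {y | δ₀ ≤ g y}
  have hA : leb2 A = ν * a := leb2_Iic_prod ν _
  have hAm : MeasurableSet A := measurableSet_Iic.prod (measurableSet_le measurable_const hg)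
  have hAfin : leb2 A < ⊤ := hA ▸ ENNReal.mul_lt_top ENNReal.coe_lt_top hlevel'.lt_top
  have hsub : {ω | ¬HasHeavyCore (fun i => weight g ν (X i ω)) δ η n} ⊆
      {ω | (count (fun i => X i ω) A : ℝ≥0∞) < leb2 A / 2} ∪
        {ω | ν * (η * δ₀ * a / 2) ≤
          ∑' i : ↥(core (fun i => weight g ν (X i ω)) δ)ᶜ, (weight g ν (X i ω) : ℝ≥0∞)} := by
    intro ω hω
    by_contra hcon
    simp only [Set.mem_union, Set.mem_ofPred_eq, not_or, not_lt, not_le] at hcon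
    refine hω (hasHeavyCore_weight_of_le_count hδ hδ₀ (hn.trans_eq (by rw [hA])) hcon.1
      (hcon.2.le.trans_eq ?_))
    rw [hA]
    simp only [div_eq_mul_inv]
    ring
  refine ((measure_mono hsub).trans (measure_union_le _ _)).trans (add_le_add ?_ ?_)
  · exact hA ▸ hX.measure_count_lt_half_le hAm hAfin
  · have hpos : η * δ₀ * a / 2 ≠ 0 := by
      simp [hη.ne', (hδ.trans_le hδ₀).ne', hlevel]
    have htop : η * δ₀ * a / 2 ≠ ⊤ := by finiteness
    have hν' : (ν : ℝ≥0∞) ≠ 0 := ENNReal.coe_ne_zero.2 hν.ne'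
    refine (meas_ge_le_lintegral_div ?_ (mul_ne_zero hν' hpos)
      (ENNReal.mul_ne_top ENNReal.coe_ne_top htop)).trans_eq ?_
    · exact (measurable_tsum_compl_core_weight hX hg hδ ν).aemeasurable
    · rw [lintegral_tsum_compl_core_weight hX hg hδ,
        ENNReal.mul_div_mul_left _ _ hν' ENNReal.coe_ne_top]

lemma exists_level_eventually_measure_not_hasHeavyCore_le (hX : IsPoissonProcess X leb2 P)
    (hg : Measurable g) (hI : ∫⁻ y, g y ∂leb ≠ ⊤) (hg0 : ¬ g =ᵐ[leb] 0) {η ρ : ℝ≥0} (hη : 0 < η)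
    (hρ : 0 < ρ) :
    ∃ δ : ℝ≥0, 0 < δ ∧ ∀ n : ℕ, ∀ᶠ ν in atTop,
      P {ω | ¬HasHeavyCore (fun i => weight g ν (X i ω)) δ η n} ≤ ρ := by
  obtain ⟨δ₀, hδ₀, hlevel⟩ := exists_measure_le_ne_zero hg0
  have hlevel' := measure_le_ne_top hg hI hδ₀
  set a := leb {y | δ₀ ≤ g y}
  have hκ : (η * δ₀ * a / 2 : ℝ≥0∞) ≠ 0 := by simp [hη.ne', hδ₀.ne', hlevel]
  have hρ' : (0 : ℝ≥0∞) < ρ / 2 := ENNReal.half_pos (ENNReal.coe_ne_zero.2 hρ.ne')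
  obtain ⟨δ, htail, hδ, hδδ₀⟩ :=
    (((tendsto_setLIntegral_lt_zero hg hI).eventually_le_const
      (ENNReal.mul_pos hρ'.ne' hκ)).and (Ioc_mem_nhdsGT hδ₀)).exists
  have hcount : Tendsto (fun ν : ℝ≥0 => ν * a / 2) atTop (𝓝 ⊤) := by
    simpa [div_eq_mul_inv, mul_assoc, hlevel] using ENNReal.Tendsto.mul_const (b := a / 2)
      (ENNReal.tendsto_coe_nhds_top.2 tendsto_id) (by simp)
  have hexp : Tendsto (fun ν : ℝ≥0 => ENNReal.ofReal (Real.exp (-((ν * a).toReal / 8)))) atTop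
      (𝓝 0) := by
    have hmean : Tendsto (fun ν : ℝ≥0 => (ν * a).toReal) atTop atTop := by
      simp only [ENNReal.toReal_mul, ENNReal.coe_toReal]
      exact (NNReal.tendsto_coe_atTop.2 tendsto_id).atTop_mul_const
        (ENNReal.toReal_pos hlevel hlevel')
    have hmean8 := hmean.atTop_div_const (by norm_num : (0 : ℝ) < 8)
    simpa using ENNReal.tendsto_ofReal (Real.tendsto_exp_neg_atTop_nhds_zero.comp hmean8)
  refine ⟨δ, hδ, fun n => ?_⟩
  filter_upwards [eventually_gt_atTop 0, hcount.eventually_const_le (ENNReal.natCast_lt_top n),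
    hexp.eventually_le_const hρ'] with ν hν hn hexp_le
  calc _ ≤ _ := measure_not_hasHeavyCore_le hX hg hI hδ hδδ₀ hlevel hη hν hn
    _ ≤ ρ / 2 + ρ / 2 := add_le_add hexp_le (ENNReal.div_le_of_le_mul htail)
    _ = ρ := ENNReal.add_halves _

end Weights

theorem measure_not_hasGiantHub_core_le {Ω ι : Type*} [MeasurableSpace Ω] {P : Measure Ω}
    [Countable ι] {ζ : Sym2 ι → Ω → ℝ} (hζ : ∀ e, Measurable (ζ e)) (hi : iIndepFun ζ P)
    (hu : ∀ e, HasLaw (ζ e) (volume.restrict (Set.Icc (0 : ℝ) 1)) P) {w : ι → ℝ≥0}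
    (hw : ∀ i j, i ≠ j → w i * w j ≤ 1) (hsum : ∑' i, (w i : ℝ≥0∞) ≠ ⊤) {δ ε η : ℝ≥0}
    (hδ : 0 < δ) (hε : 0 < ε) {n : ℕ} (hcore : HasHeavyCore w δ η n) {c : ℝ≥0∞}
    (hc : ∀ k ≥ n, (k.descFactorial 2 : ℝ≥0∞) * (1 - (δ : ℝ≥0∞) ^ 4) ^ (k - 2) ≤ c) :
    P {ω | ¬HasGiantHub (edgeGraph (edgeEvent ζ w) ω) (core w δ) ε} ≤ c + 2 * η / ε := by
  obtain ⟨hn, hη⟩ := hcore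
  obtain ⟨K, hK⟩ := (finite_core hsum hδ).exists_finset_coe
  have hmem {i : ι} (hi : i ∈ K) : δ ≤ w i := (hK ▸ hi : i ∈ core w δ)
  rw [← hK] at hn hη ⊢
  rw [Finset.tsum_subtype' K fun i => (w i : ℝ≥0∞)] at hη
  rw [Set.encard_coe_eq_coe_finsetCard, Nat.cast_le] at hn
  refine (measure_not_hasGiantHub_edgeEvent_le hζ hi hu hw hsum hε (fun i => hmem) hη).trans ?_
  gcongr
  exact hc _ hn

section IndexGraph

/-- The `ν`-truncation with respect to the kernel `g x * g y`, without self edges, as a graph on the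
indices of the latent points instead of their labels. -/
def indexGraph (g : ℝ≥0 → ℝ≥0) (ν : ℝ≥0) (x : ℕ → ℝ≥0 × ℝ≥0) (z : Sym2 ℕ → ℝ) : SimpleGraph ℕ :=
  edgeGraph (edgeEvent (fun e z => z e) fun i => weight g ν (x i)) z

variable {f : ℝ≥0 → ℝ} {ν : ℝ≥0} {x : ℕ → ℝ≥0 × ℝ≥0} {z : Sym2 ℕ → ℝ}

lemma indexGraph_adj {g : ℝ≥0 → ℝ≥0} {i j : ℕ} : (indexGraph g ν x z).Adj i j ↔
    z s(i, j) < (weight g ν (x i) * weight g ν (x j) : ℝ≥0) ∧ i ≠ j :=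
  edgeGraph_adj

lemma isEdge_iff_indexGraph_adj (hW : IsGraphex (separable f))
    (hθ : Function.Injective fun i => (x i).1) (hϑ : Function.Injective fun i => (x i).2)
    (hz : ∀ e, 0 ≤ z e) {i j : ℕ} :
    IsEdge (separable f) x z ν (x i).1 (x j).1 ↔ (indexGraph (fun y => ‖f y‖₊) ν x z).Adj i j := by
  have hlabels : IsEdge (separable f) x z ν (x i).1 (x j).1 ↔
      (x i).1 ≤ ν ∧ (x j).1 ≤ ν ∧ z s(i, j) < separable f (x i).2 (x j).2 := by
    refine and_congr_right' (and_congr_right' ⟨?_, fun h => ⟨i, j, rfl, rfl, h⟩⟩)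
    rintro ⟨i', j', hi, hj, h⟩
    rwa [hθ hi, hθ hj] at h
  rw [hlabels, indexGraph_adj]
  rcases eq_or_ne i j with rfl | hij
  · simp [separable, hz]
  · rw [← nnnorm_mul_nnnorm_eq_separable hW (hϑ.ne hij)]
    by_cases hi : (x i).1 ≤ ν <;> by_cases hj : (x j).1 ≤ ν <;> simp [weight, hi, hj, hij, hz]

lemma vertexSet_eq_image_support (hW : IsGraphex (separable f))
    (hθ : Function.Injective fun i => (x i).1) (hϑ : Function.Injective fun i => (x i).2)
    (hz : ∀ e, 0 ≤ z e) : vertexSet (separable f) x z ν =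
      (fun i => (x i).1) '' (indexGraph (fun y => ‖f y‖₊) ν x z).support := by
  have hiff {i j : ℕ} := isEdge_iff_indexGraph_adj (ν := ν) (i := i) (j := j) hW hθ hϑ hz
  ext a
  constructor
  · rintro ⟨b, hab⟩
    obtain ⟨-, -, i, j, rfl, rfl, -⟩ := id hab
    exact ⟨i, ⟨j, hiff.1 hab⟩, rfl⟩
  · rintro ⟨i, ⟨j, hij⟩, rfl⟩
    exact ⟨(x j).1, hiff.2 hij⟩

lemma nonempty_iso_graph (hW : IsGraphex (separable f))
    (hθ : Function.Injective fun i => (x i).1) (hϑ : Function.Injective fun i => (x i).2)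
    (hz : ∀ e, 0 ≤ z e) :
    Nonempty ((indexGraph (fun y => ‖f y‖₊) ν x z).induce
      (indexGraph (fun y => ‖f y‖₊) ν x z).support ≃g graph (separable f) x z ν) := by
  have hvertex := vertexSet_eq_image_support (ν := ν) hW hθ hϑ hz
  refine ⟨⟨(Equiv.Set.image _ _ hθ).trans (Equiv.setCongr hvertex.symm), @fun i j => ?_⟩⟩
  change _ ≠ _ ∧ (IsEdge (separable f) x z ν (x i).1 (x j).1 ∨
    IsEdge (separable f) x z ν (x j).1 (x i).1) ↔
      (indexGraph (fun y => ‖f y‖₊) ν x z).Adj i j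
  rw [isEdge_iff_indexGraph_adj hW hθ hϑ hz, isEdge_iff_indexGraph_adj hW hθ hϑ hz,
    SimpleGraph.adj_comm _ (j : ℕ), or_self, (Equiv.injective _).ne_iff, Ne, Subtype.ext_iff]
  exact and_iff_right_of_imp SimpleGraph.Adj.ne

theorem HasGiantHub.lt_largestComponentSize_graph (hW : IsGraphex (separable f))
    (hθ : Function.Injective fun i => (x i).1) (hϑ : Function.Injective fun i => (x i).2)
    (hz : ∀ e, 0 ≤ z e) {K : Set ℕ} (hK : K.Nontrivial) {ε : ℝ≥0} (hε : 0 < ε)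
    (h : HasGiantHub (indexGraph (fun y => ‖f y‖₊) ν x z) K ε) :
    (vertexSet (separable f) x z ν).Finite ∧
      (1 - ε : ℝ) * (vertexSet (separable f) x z ν).ncard <
        (largestComponentSize (graph (separable f) x z ν)).toNat := by
  obtain ⟨φ⟩ := nonempty_iso_graph (ν := ν) hW hθ hϑ hz
  rw [← largestComponentSize_congr φ, vertexSet_eq_image_support hW hθ hϑ hz,
    Set.ncard_image_of_injective _ hθ]
  exact ⟨h.finite_support.image _, h.lt_largestComponentSize hK hε⟩

end IndexGraph

section Latent

variable {Ω : Type*} [MeasurableSpace Ω] {P : Measure Ω} {X : ℕ → Ω → ℝ≥0 × ℝ≥0}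
  {ζ : Sym2 ℕ → Ω → ℝ}

lemma IsPoissonProcess.ae_injective_fst (hX : IsPoissonProcess X leb2 P) :
    ∀ᵐ ω ∂P, Function.Injective fun i => (X i ω).1 :=
  hX.ae_injective_comp measurable_fst fun a => by
    rw [← Set.prod_univ, leb2, Measure.prod_prod, measure_singleton, zero_mul]

lemma IsPoissonProcess.ae_injective_snd (hX : IsPoissonProcess X leb2 P) :
    ∀ᵐ ω ∂P, Function.Injective fun i => (X i ω).2 :=
  hX.ae_injective_comp measurable_snd fun a => by
    rw [← Set.univ_prod, leb2, Measure.prod_prod, measure_singleton, mul_zero]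

namespace IsLatent

lemma ae_nonneg (hX : IsLatent X ζ P) : ∀ᵐ ω ∂P, ∀ e, 0 ≤ ζ e ω := by
  refine ae_all_iff.2 fun e => ((hX.uniform e).ae_iff (p := (0 ≤ ·)) ?_).2 ?_
  · exact measurableSet_setOfPred.1 measurableSet_Ici
  · filter_upwards [ae_restrict_mem measurableSet_Icc] with t ht using ht.1

lemma measure_eq_lintegral [IsProbabilityMeasure P] (hX : IsLatent X ζ P)
    {S : Set ((ℕ → ℝ≥0 × ℝ≥0) × (Sym2 ℕ → ℝ))} (hS : MeasurableSet S) :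
    P {ω | ((fun i => X i ω), fun e => ζ e ω) ∈ S} =
      ∫⁻ ω, P {ω' | ((fun i => X i ω), fun e => ζ e ω') ∈ S} ∂P := by
  have hXm : Measurable fun ω i => X i ω := measurable_pi_lambda _ hX.poisson.measurable
  have hζm : Measurable fun ω e => ζ e ω := measurable_pi_lambda _ hX.measurable
  calc P {ω | ((fun i => X i ω), fun e => ζ e ω) ∈ S}
      = P.map (fun ω => ((fun i => X i ω), fun e => ζ e ω)) S :=
        (Measure.map_apply (hXm.prodMk hζm) hS).symm
    _ = ((P.map fun ω i => X i ω).prod (P.map fun ω e => ζ e ω)) S := by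
        rw [(indepFun_iff_map_prod_eq_prod_map_map hXm.aemeasurable hζm.aemeasurable).1 hX.indep]
    _ = ∫⁻ ω, P {ω' | ((fun i => X i ω), fun e => ζ e ω') ∈ S} ∂P := by
        have := Measure.isProbabilityMeasure_map (μ := P) hζm.aemeasurable
        rw [Measure.prod_apply hS, lintegral_map (measurable_measure_prodMk_left hS) hXm]
        exact lintegral_congr fun ω => Measure.map_apply hζm (measurable_prodMk_left hS)

end IsLatent

variable {g : ℝ≥0 → ℝ≥0}

lemma measurableSet_hasGiantHub_indexGraph (hg : Measurable g) (ν δ ε : ℝ≥0) :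
    MeasurableSet {p : (ℕ → ℝ≥0 × ℝ≥0) × (Sym2 ℕ → ℝ) |
      HasGiantHub (indexGraph g ν p.1 p.2) (core (fun i => weight g ν (p.1 i)) δ) ε} := by
  have hw (i : ℕ) : Measurable fun p : (ℕ → ℝ≥0 × ℝ≥0) × (Sym2 ℕ → ℝ) => weight g ν (p.1 i) :=
    (measurable_weight hg ν).comp (by fun_prop)
  refine measurableSet_setOfPred.2 (measurable_hasGiantHub (fun i j => ?_) ?_ ε)
  · simp only [indexGraph_adj]
    exact (measurableSet_setOfPred.1 (measurableSet_lt (by fun_prop)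
      ((hw i).mul (hw j)).coe_nnreal_real)).and measurable_const
  · exact measurable_set_iff.2 fun i =>
      measurableSet_setOfPred.1 (measurableSet_le measurable_const (hw i))

lemma measure_not_hasGiantHub_indexGraph_le [IsProbabilityMeasure P] (hX : IsLatent X ζ P)
    (hg : Measurable g) (hI : ∫⁻ y, g y ∂leb ≠ ⊤) (hle : ∀ {x y}, x ≠ y → g x * g y ≤ 1)
    {ν δ ε η : ℝ≥0} (hδ : 0 < δ) (hε : 0 < ε) {n : ℕ} {c : ℝ≥0∞}
    (hc : ∀ k ≥ n, (k.descFactorial 2 : ℝ≥0∞) * (1 - (δ : ℝ≥0∞) ^ 4) ^ (k - 2) ≤ c) :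
    P {ω | ¬HasGiantHub (indexGraph g ν (fun i => X i ω) fun e => ζ e ω)
        (core (fun i => weight g ν (X i ω)) δ) ε} ≤
      c + 2 * η / ε + P {ω | ¬HasHeavyCore (fun i => weight g ν (X i ω)) δ η n} := by
  set B := {ω | ¬HasHeavyCore (fun i => weight g ν (X i ω)) δ η n}
  have hcond : ∀ᵐ ω ∂P, P {ω' | ¬HasGiantHub (indexGraph g ν (fun i => X i ω) fun e => ζ e ω')
      (core (fun i => weight g ν (X i ω)) δ) ε} ≤
        c + 2 * η / ε + (toMeasurable P B).indicator 1 ω := by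
    filter_upwards [hX.poisson.ae_injective_snd, ae_tsum_weight_ne_top hX.poisson hg hI ν]
      with ω hϑ hsum
    by_cases hω : ω ∈ B
    · rw [Set.indicator_of_mem (subset_toMeasurable P B hω)]
      exact prob_le_one.trans le_add_self
    · have hw (i j : ℕ) (hij : i ≠ j) : weight g ν (X i ω) * weight g ν (X j ω) ≤ 1 := by
        by_cases hi : (X i ω).1 ≤ ν <;> by_cases hj : (X j ω).1 ≤ ν <;>
          simp [weight, hi, hj, hle (hϑ.ne hij)]
      exact (measure_not_hasGiantHub_core_le hX.measurable hX.iIndep hX.uniform hw hsum hδ hε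
        (not_not.1 hω) hc).trans le_self_add
  calc _ = _ := hX.measure_eq_lintegral (measurableSet_hasGiantHub_indexGraph hg ν δ ε).compl
    _ ≤ ∫⁻ ω, (c + 2 * η / ε + (toMeasurable P B).indicator 1 ω) ∂P := lintegral_mono_ae hcond
    _ = c + 2 * η / ε + P B := by
        rw [lintegral_add_left measurable_const, lintegral_const, measure_univ, mul_one,
          lintegral_indicator_one (measurableSet_toMeasurable _ _), measure_toMeasurable]

theorem eventually_measure_not_hasGiantHub_indexGraph_le [IsProbabilityMeasure P]
    (hX : IsLatent X ζ P) (hg : Measurable g) (hI : ∫⁻ y, g y ∂leb ≠ ⊤) (hg0 : ¬ g =ᵐ[leb] 0)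
    (hle : ∀ {x y}, x ≠ y → g x * g y ≤ 1) {ε ρ : ℝ≥0} (hε : 0 < ε) (hρ : 0 < ρ) :
    ∃ δ, ∀ᶠ ν in atTop, P {ω | ¬((core (fun i => weight g ν (X i ω)) δ).Nontrivial ∧
      HasGiantHub (indexGraph g ν (fun i => X i ω) fun e => ζ e ω)
        (core (fun i => weight g ν (X i ω)) δ) ε)} ≤ ρ := by
  obtain ⟨δ, hδ, hheavy⟩ := exists_level_eventually_measure_not_hasHeavyCore_le hX.poisson hg hI hg0
    (η := ε * ρ / 8) (ρ := ρ / 4) (by positivity) (by positivity)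
  have hq : 1 - (δ : ℝ≥0∞) ^ 4 < 1 := ENNReal.sub_lt_self (by simp) (by simp) (by simp [hδ.ne'])
  obtain ⟨n, hn⟩ := eventually_atTop.1 ((tendsto_descFactorial_mul_pow hq).eventually_le_const
    (ENNReal.coe_pos.2 (by positivity : 0 < ρ / 4)))
  refine ⟨δ, (hheavy (max n 2)).mono fun ν hν => ?_⟩
  have hsub : {ω | ¬((core (fun i => weight g ν (X i ω)) δ).Nontrivial ∧
      HasGiantHub (indexGraph g ν (fun i => X i ω) fun e => ζ e ω)
        (core (fun i => weight g ν (X i ω)) δ) ε)} ⊆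
      {ω | ¬HasGiantHub (indexGraph g ν (fun i => X i ω) fun e => ζ e ω)
        (core (fun i => weight g ν (X i ω)) δ) ε} ∪
      {ω | ¬HasHeavyCore (fun i => weight g ν (X i ω)) δ (ε * ρ / 8) (max n 2)} := by
    intro ω hω
    by_contra hcon
    obtain ⟨hgiant, hcore⟩ := not_or.1 hcon
    refine hω ⟨Set.one_lt_encard_iff_nontrivial.1 ?_, not_not.1 hgiant⟩
    exact lt_of_lt_of_le (by exact_mod_cast le_max_right n 2) (not_not.1 hcore).le_encard
  calc _ ≤ _ := (measure_mono hsub).trans (measure_union_le _ _)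
    _ ≤ ((ρ / 4 : ℝ≥0) + 2 * (ε * ρ / 8 : ℝ≥0) / ε + (ρ / 4 : ℝ≥0)) + (ρ / 4 : ℝ≥0) := by
        gcongr
        exact (measure_not_hasGiantHub_indexGraph_le hX hg hI hle hδ hε fun k hk =>
          hn k ((le_max_left n 2).trans hk)).trans (by gcongr)
    _ = ρ := by
        rw [← ENNReal.coe_ofNat, ← ENNReal.coe_mul, ← ENNReal.coe_div hε.ne']
        norm_cast
        field_simp
        norm_num

end Latent

end KEG

theorem mainTheorem8 {Ω : Type*} [MeasurableSpace Ω] (P : Measure Ω) [IsProbabilityMeasure P]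
    (X : ℕ → Ω → ℝ≥0 × ℝ≥0) (ζ : Sym2 ℕ → Ω → ℝ) (hX : KEG.IsLatent X ζ P)
    (f : ℝ≥0 → ℝ) (hW : KEG.IsGraphex (KEG.separable f))
    (hf : ¬ ∀ᵐ x ∂KEG.leb, f x = 0)
    (ε : ℝ) (hε : 0 < ε) :
    Tendsto
      (fun ν : ℝ≥0 => P {ω |
        (KEG.vertexSet (KEG.separable f) (fun i => X i ω) (fun e => ζ e ω) ν).Finite ∧
        (1 - ε) *
            ((KEG.vertexSet (KEG.separable f) (fun i => X i ω) (fun e => ζ e ω) ν).ncard : ℝ)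
          < ((KEG.largestComponentSize
              (KEG.graph (KEG.separable f) (fun i => X i ω) (fun e => ζ e ω) ν)).toNat : ℝ)})
      atTop (𝓝 1) := by
  lift ε to ℝ≥0 using hε.le
  rw [NNReal.coe_pos] at hε
  have hg0 : ¬ (fun x => ‖f x‖₊) =ᵐ[KEG.leb] 0 := by
    simpa [Filter.EventuallyEq] using hf
  refine KEG.tendsto_measure_one_of_compl (ENNReal.tendsto_nhds_zero.2 fun ρ hρ => ?_)
  obtain ⟨r, hr, hrρ⟩ := ENNReal.lt_iff_exists_nnreal_btwn.1 hρ
  obtain ⟨δ, hδ⟩ := KEG.eventually_measure_not_hasGiantHub_indexGraph_le hX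
    (KEG.measurable_of_isGraphex_separable hW).nnnorm (KEG.lintegral_nnnorm_ne_top hW hf) hg0
    (KEG.nnnorm_mul_nnnorm_le_one hW) hε (ENNReal.coe_pos.1 hr)
  filter_upwards [hδ] with ν hν
  refine (measure_mono_ae ?_).trans (hν.trans hrρ.le)
  filter_upwards [hX.poisson.ae_injective_fst, hX.poisson.ae_injective_snd, hX.ae_nonneg]
    with ω hθ hϑ hz hω hgiant
  exact hω (hgiant.2.lt_largestComponentSize_graph hW hθ hϑ hz hgiant.1 hε)
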